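/- **Setting.** All logarithms are to base $2$, all Hilbert spaces are finite-dimensional, and $D(\rho,\sigma)=\operatorname{Tr}|\rho-\sigma|$. A unit vector $|\psi\rangle\in\mathbb C^p\otimes\mathbb C^q$ is called separable if it is a product vector, and maximally entangled if $|\psi\rangle=r^{-1/2}\sum_{k=1}^r|u_k\rangle|v_k\rangle$ for some $r\ge 1$ and some orthonormal systems $(u_k)$ in $\mathbb C^p$ and $(v_k)$ in $\mathbb C^q$ (so $r$ may be smaller than $p$ and $q$; equivalently, all non-zero Schmidt coefficients are equal). Its entropy of entanglement is $E=S(\operatorname{Tr}_B|\psi\rangle\langle\psi|)$, with $S$ the von Neumann entropy. Put $|\Phi_d\rangle=d^{-1/2}\sum_{i=1}^d|i\rangle|i\rangle$. An LOCC protocol using $c$ bits of classical communication is a two-way protocol in which at most $c$ bits in total are sent, in either direction. In each step one party, determined by the bits sent so far, applies a two-outcome quantum instrument, which may depend on the bits sent so far, to its own system and sends the outcome bit to the other party; local systems may have any finite dimensions. When the communication is over, each party applies a local operation, depending on the bits sent, that yields its output system and a flag, success or failure. The protocol succeeds if both flags say success. It transforms $|\Phi_d\rangle$ into $|\psi\rangle^{\otimes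 n}$ with error $\epsilon$ and success probability $2^{-s}$ ($s$ real) if, on input $|\Phi_d\rangle$, it succeeds with probability at least $2^{-s}$ and its output state $\sigma$ conditioned on success satisfies $D(\sigma,|\psi\rangle\langle\psi|^{\otimes n})\le\epsilon$. **Theorem.** There is a universal constant $\epsilon_0\ge 0.01$ with the following property. For every bipartite pure state $|\psi\rangle\in\mathbb C^p\otimes\mathbb C^q$ that is neither separable nor maximally entangled there exist constants $\alpha>0$ and $n_0$, depending only on $|\psi\rangle$, such that for all $\epsilon\le\epsilon_0$, all $n\ge n_0$, all $d,c\in\mathbb N$ and all $s\in\mathbb R$, every LOCC protocol that transforms $|\Phi_d\rangle$ into $|\psi\rangle^{\otimes n}$ with error $\epsilon$ and success probability $2^{-s}$, using $c$ bits of classical communication, satisfies (a) $\log d\ge nE+\alpha\sqrt n$, and (b) $c+s\ge\alpha\sqrt n$. -/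

import Mathlib

noncomputable section

open scoped Kronecker MatrixOrder

namespace EntanglementDilution

/-! ### States -/

/-- The density matrix `|v⟩⟨v|`. -/
def pureState {X : Type} (v : X → ℂ) : Matrix X X ℂ :=
  Matrix.vecMulVec v (star v)

/-- The partial trace over the second (Bob's) tensor factor. -/
def traceB {X Y : Type} [Fintype Y] (ρ : Matrix (X × Y) (X × Y) ℂ) : Matrix X X ℂ :=
  Matrix.of fun x x' => ∑ y, ρ (x, y) (x', y)

theorem isHermitian_pureState {X : Type} (v : X → ℂ) : (pureState v).IsHermitian := by
  ext i j
  simp [pureState, Matrix.vecMulVec_apply, mul_comm]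

theorem isHermitian_traceB {X Y : Type} [Fintype Y] {ρ : Matrix (X × Y) (X × Y) ℂ}
    (h : ρ.IsHermitian) : (traceB ρ).IsHermitian := by
  ext i j
  simp only [traceB, Matrix.conjTranspose_apply, Matrix.of_apply, star_sum]
  exact Finset.sum_congr rfl fun y _ => h.apply _ _

/-- The von Neumann entropy, in bits, of a Hermitian matrix: `-∑ λ log₂ λ` over its eigenvalues. -/
def entropy {X : Type} [Fintype X] [DecidableEq X] (ρ : Matrix X X ℂ) (h : ρ.IsHermitian) : ℝ :=
  -∑ i, h.eigenvalues i * Real.logb 2 (h.eigenvalues i)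

/-- The entropy of entanglement of `|ψ⟩ ∈ ℂ^p ⊗ ℂ^q`: the entropy of Alice's reduced state. -/
def entanglementEntropy {p q : ℕ} (ψ : EuclideanSpace ℂ (Fin p × Fin q)) : ℝ :=
  entropy (traceB (pureState ψ.ofLp)) (isHermitian_traceB (isHermitian_pureState _))

/-- A pure state is separable if it is a product vector. -/
def IsSeparable {p q : ℕ} (ψ : EuclideanSpace ℂ (Fin p × Fin q)) : Prop :=
  ∃ (u : EuclideanSpace ℂ (Fin p)) (v : EuclideanSpace ℂ (Fin q)), ∀ i j, ψ (i, j) = u i * v j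

/-- `|ψ⟩` is maximally entangled (of some dimension `r`, possibly smaller than `p` and `q`):
`|ψ⟩ = r^{-1/2} ∑ₖ |uₖ⟩|vₖ⟩` with `r` orthonormal vectors on either side. -/
def IsMaximallyEntangled {p q : ℕ} (ψ : EuclideanSpace ℂ (Fin p × Fin q)) : Prop :=
  ∃ (r : ℕ) (u : Fin r → EuclideanSpace ℂ (Fin p)) (v : Fin r → EuclideanSpace ℂ (Fin q)),
    Orthonormal ℂ u ∧ Orthonormal ℂ v ∧
      ∀ i j, ψ (i, j) = ((√(r : ℝ))⁻¹ : ℝ) * ∑ k, u k i * v k j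

/-- `|Φ_d⟩ = d^{-1/2} ∑ᵢ |i⟩|i⟩`. -/
def maxEntangled (d : ℕ) : Fin d × Fin d → ℂ :=
  fun x => if x.1 = x.2 then (((√(d : ℝ))⁻¹ : ℝ) : ℂ) else 0

/-- `|ψ⟩^{⊗n}`, with Alice holding the `n` first factors and Bob the `n` second factors. -/
def tensorPow {p q : ℕ} (ψ : EuclideanSpace ℂ (Fin p × Fin q)) (n : ℕ) :
    (Fin n → Fin p) × (Fin n → Fin q) → ℂ :=
  fun x => ∏ k, ψ (x.1 k, x.2 k)

/-- The trace distance `D(ρ, σ) = Tr |ρ - σ|` (without a factor `1/2`). -/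
def traceDist {X : Type} [Fintype X] [DecidableEq X] (ρ σ : Matrix X X ℂ) : ℝ :=
  (CFC.abs (ρ - σ)).trace.re

/-! ### LOCC protocols -/

/-- A two-outcome quantum instrument on a system with basis `X`: for each outcome `m` a completely
positive map, given by Kraus operators, into a system with basis `Y m`; the sum of the two maps
preserves the trace. -/
structure Instrument (X : Type) [Fintype X] [DecidableEq X]
    (Y : Bool → Type) [∀ m, Fintype (Y m)] where
  /-- number of Kraus operators -/
  num : Bool → ℕ
  /-- the Kraus operators -/
  kraus : (m : Bool) → Fin (num m) → Matrix (Y m) X ℂ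
  complete : ∑ m, ∑ k, (kraus m k).conjTranspose * kraus m k = 1

/-- The unnormalized state after Alice applied the instrument and saw outcome `m`. -/
def Instrument.applyA {X Z : Type} [Fintype X] [DecidableEq X] [Fintype Z] [DecidableEq Z]
    {Y : Bool → Type} [∀ m, Fintype (Y m)] (I : Instrument X Y) (m : Bool)
    (ρ : Matrix (X × Z) (X × Z) ℂ) : Matrix (Y m × Z) (Y m × Z) ℂ :=
  ∑ k, (I.kraus m k ⊗ₖ (1 : Matrix Z Z ℂ)) * ρ * (I.kraus m k ⊗ₖ (1 : Matrix Z Z ℂ)).conjTranspose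

/-- The unnormalized state after Bob applied the instrument and saw outcome `m`. -/
def Instrument.applyB {X Z : Type} [Fintype X] [DecidableEq X] [Fintype Z] [DecidableEq Z]
    {Y : Bool → Type} [∀ m, Fintype (Y m)] (I : Instrument X Y) (m : Bool)
    (ρ : Matrix (Z × X) (Z × X) ℂ) : Matrix (Z × Y m) (Z × Y m) ℂ :=
  ∑ k, ((1 : Matrix Z Z ℂ) ⊗ₖ I.kraus m k) * ρ * ((1 : Matrix Z Z ℂ) ⊗ₖ I.kraus m k).conjTranspose

/-- `Protocol X Y a b c`: two-way LOCC protocols in which Alice and Bob currently hold systems of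
dimensions `a` and `b`, have at most `c` bits of classical communication (in total, in either
direction) left, and finally output systems with bases `X` and `Y`.

In a communication step one party applies an arbitrary instrument to everything it holds and sends
the one-bit outcome to the other party; everything that follows, including who speaks next, may
depend on the bits sent so far. Ancillas, discarded subsystems, local randomness and private
measurement results are covered, since the instruments are arbitrary completely positive maps
between systems of arbitrary finite dimensions. At the end, without further communication, each
party applies a local operation that produces its output and a flag (`true` for success). -/
inductive Protocol (X Y : Type) [Fintype X] [Fintype Y] : ℕ → ℕ → ℕ → Type
  | done {a b c : ℕ} (opA : Instrument (Fin a) fun _ => X) (opB : Instrument (Fin b) fun _ => Y) :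
      Protocol X Y a b c
  | alice {a b c : ℕ} (a' : Bool → ℕ) (I : Instrument (Fin a) fun m => Fin (a' m))
      (next : (m : Bool) → Protocol X Y (a' m) b c) : Protocol X Y a b (c + 1)
  | bob {a b c : ℕ} (b' : Bool → ℕ) (I : Instrument (Fin b) fun m => Fin (b' m))
      (next : (m : Bool) → Protocol X Y a (b' m) c) : Protocol X Y a b (c + 1)

/-- The unnormalized output state on the event of success (both final flags are `true`), summed
over all transcripts. Its trace is the probability of success. -/
def Protocol.run {X Y : Type} [Fintype X] [Fintype Y] [DecidableEq X] [DecidableEq Y] :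
    {a b c : ℕ} → Protocol X Y a b c → Matrix (Fin a × Fin b) (Fin a × Fin b) ℂ →
      Matrix (X × Y) (X × Y) ℂ
  | _, _, _, .done opA opB, ρ => opB.applyB true (opA.applyA true ρ)
  | _, _, _, .alice _ I next, ρ => ∑ m, (next m).run (I.applyA m ρ)
  | _, _, _, .bob _ I next, ρ => ∑ m, (next m).run (I.applyB m ρ)

/-- The probability that the protocol succeeds on input `ρ`. -/
def Protocol.successProb {X Y : Type} [Fintype X] [Fintype Y] [DecidableEq X] [DecidableEq Y]
    {a b c : ℕ} (P : Protocol X Y a b c) (ρ : Matrix (Fin a × Fin b) (Fin a × Fin b) ℂ) : ℝ :=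
  (P.run ρ).trace.re

/-- The (normalized) output state conditioned on success. -/
def Protocol.output {X Y : Type} [Fintype X] [Fintype Y] [DecidableEq X] [DecidableEq Y]
    {a b c : ℕ} (P : Protocol X Y a b c) (ρ : Matrix (Fin a × Fin b) (Fin a × Fin b) ℂ) :
    Matrix (X × Y) (X × Y) ℂ :=
  (P.successProb ρ : ℂ)⁻¹ • P.run ρ

end EntanglementDilution

end

noncomputable section

open scoped Kronecker MatrixOrder

namespace EntanglementDilution

/-! A bipartite vector is treated as its matrix of amplitudes, so that Schmidt coefficients are
singular values and local operators act by left and right multiplication. On success a protocol with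
`c` bits is a sum over at most `2 ^ c` transcripts of products of local maps
(`Protocol.exists_kraus`). Hence each branch of its output on `|Φ_d⟩` is an unnormalized vector
`d^{-1/2} A Bᵀ`, where `A` and `B` are contractions meeting in dimension `d`. Trace distance at most
`1 / 100` forces fidelity at least `99 / 100` with `ψ^{⊗n}`.

The squared Schmidt coefficients of `ψ^{⊗n}` are products of `n` weights. Under the distribution
they define, their negative logarithm is a sum of `n` independent variables with mean `nE`. Since
`ψ` is not maximally entangled, the variance is positive, and a fourth moment argument gives both
tails at distance `β √n` probability at least `1 / 13` (`exists_anticoncentration`).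

For (a), every branch has Schmidt rank at most `d`, whatever was communicated. If `d` is far below
`2 ^ (nE + β √n)`, a branch captures almost nothing of the tail of small coefficients
(`norm_overlap_le_of_rank`), so the fidelity stays too low.

For (b), a branch made from `|Φ_d⟩` by contractions sees only Schmidt weights within a window around
`1 / d`, up to a small additive error (`norm_overlap_le_of_contractions`). The error is absolute: a
branch of small probability may have spread-out coefficients. Summed over `2 ^ c` transcripts, it is
negligible against the success probability `2 ^ (-s)` once the window has logarithmic width about `2
(c + s)` plus a constant (`window_le_of_fidelity`). Such a window must carry more than `12 / 13` of
the weight, so its width is at least `2 β √n`. Kraus outcomes that are never sent make each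
transcript a mixture; they are kept coherently as extra local systems, and the target is tensored
with a suitable state on them (`sqrt_sum_norm_overlap_sq_le`). -/

/-- The squared Frobenius norm. -/
def frobSq {X Y : Type} [Fintype X] [Fintype Y] (M : Matrix X Y ℂ) : ℝ :=
  ∑ x, ∑ y, ‖M x y‖ ^ 2

/-- The Hilbert–Schmidt inner product `⟨W, V⟩`. -/
def overlap {X Y : Type} [Fintype X] [Fintype Y] (W V : Matrix X Y ℂ) : ℂ :=
  ∑ x, ∑ y, star (W x y) * V x y

/-! ### Schmidt decompositions and overlap bounds -/

section
open Matrix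
open scoped Matrix.Norms.L2Operator ComplexOrder

set_option linter.unusedSectionVars false

variable {X Y Z ι : Type} [Fintype X] [Fintype Y] [Fintype Z] [Fintype ι]
  [DecidableEq X] [DecidableEq Y] [DecidableEq Z] [DecidableEq ι]

theorem frobSq_nonneg (M : Matrix X Y ℂ) : 0 ≤ frobSq M := by
  unfold frobSq; positivity

theorem frobSq_conjTranspose (M : Matrix X Y ℂ) : frobSq Mᴴ = frobSq M := by
  unfold frobSq
  rw [Finset.sum_comm]
  simp

theorem sum_norm_mulVec_sq_le (M : Matrix X Y ℂ) (v : Y → ℂ) :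
    ∑ x, ‖(M *ᵥ v) x‖ ^ 2 ≤ ‖M‖ ^ 2 * ∑ y, ‖v y‖ ^ 2 := by
  have h := l2_opNorm_mulVec M (WithLp.toLp 2 v)
  have h2 := pow_le_pow_left₀ (norm_nonneg _) h 2
  rw [mul_pow, EuclideanSpace.norm_sq_eq, EuclideanSpace.norm_sq_eq] at h2
  simpa using h2

theorem sum_norm_col_sq_le (M : Matrix X Y ℂ) (y : Y) : ∑ x, ‖M x y‖ ^ 2 ≤ ‖M‖ ^ 2 := by
  have h := sum_norm_mulVec_sq_le M (Pi.single y 1)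
  have e : ∑ y', ‖(Pi.single y (1 : ℂ) : Y → ℂ) y'‖ ^ 2 = 1 := by
    rw [Finset.sum_eq_single y] <;> simp +contextual
  simpa [e] using h

theorem sum_norm_row_sq_le (M : Matrix X Y ℂ) (x : X) : ∑ y, ‖M x y‖ ^ 2 ≤ ‖M‖ ^ 2 := by
  have h := sum_norm_col_sq_le Mᴴ x
  rw [l2_opNorm_conjTranspose] at h
  simpa using h

theorem frobSq_mul_le_left (M : Matrix X Y ℂ) (N : Matrix Y Z ℂ) :
    frobSq (M * N) ≤ ‖M‖ ^ 2 * frobSq N := by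
  unfold frobSq
  rw [Finset.sum_comm, Finset.sum_comm (f := fun y z => ‖N y z‖ ^ 2), Finset.mul_sum]
  refine Finset.sum_le_sum fun z _ => ?_
  exact sum_norm_mulVec_sq_le M (fun y => N y z)

theorem frobSq_mul_le_right (M : Matrix X Y ℂ) (N : Matrix Y Z ℂ) :
    frobSq (M * N) ≤ frobSq M * ‖N‖ ^ 2 := by
  have h := frobSq_mul_le_left Nᴴ Mᴴ
  rwa [← conjTranspose_mul, frobSq_conjTranspose, frobSq_conjTranspose,
    l2_opNorm_conjTranspose, mul_comm] at h

theorem norm_le_one_of_conjTranspose_mul_self_le_one {M : Matrix X Y ℂ} (h : Mᴴ * M ≤ 1) :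
    ‖M‖ ≤ 1 := by
  have h0 : (0 : Matrix Y Y ℂ) ≤ Mᴴ * M := (posSemidef_conjTranspose_mul_self M).nonneg
  have h1 := (CStarAlgebra.norm_le_one_iff_of_nonneg (Mᴴ * M) h0).2 h
  rw [l2_opNorm_conjTranspose_mul_self] at h1
  nlinarith [norm_nonneg M]

/-- Transposition preserves positivity. The transposed form is needed because Bob's operators enter
the amplitude matrix transposed. -/
theorem norm_transpose_le_one_of_conjTranspose_mul_self_le_one {M : Matrix X Y ℂ}
    (h : Mᴴ * M ≤ 1) : ‖Mᵀ‖ ≤ 1 := by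
  rw [← l2_opNorm_conjTranspose]
  refine norm_le_one_of_conjTranspose_mul_self_le_one ?_
  have h2 := (Matrix.le_iff.1 h).transpose
  rw [Matrix.le_iff]
  have e : (1 - Mᴴ * M)ᵀ = 1 - Mᵀᴴᴴ * Mᵀᴴ := by
    rw [transpose_sub, transpose_mul, transpose_one, conjTranspose_conjTranspose]; rfl
  rwa [e] at h2

theorem overlap_eq_trace (W V : Matrix X Y ℂ) : overlap W V = (Wᴴ * V).trace := by
  unfold overlap
  rw [Finset.sum_comm]
  simp [trace, Matrix.mul_apply]

/-- `W` has a Schmidt decomposition with squared Schmidt coefficients `w`. -/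
def HasSchmidt (W : Matrix X Y ℂ) (w : ι → ℝ) : Prop :=
  ∃ (E : Matrix X ι ℂ) (G : Matrix ι Y ℂ),
    Eᴴ * E = 1 ∧ G * Gᴴ = diagonal (fun i => (w i : ℂ)) ∧ W = E * G

theorem HasSchmidt.nonneg {W : Matrix X Y ℂ} {w : ι → ℝ} (h : HasSchmidt W w) (i : ι) :
    0 ≤ w i := by
  obtain ⟨E, G, -, hG, -⟩ := h
  have h1 := (posSemidef_self_mul_conjTranspose G)
  rw [hG, posSemidef_diagonal_iff] at h1
  exact_mod_cast h1 i

theorem row_eq_zero {G : Matrix ι Y ℂ} {w : ι → ℝ}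
    (hG : G * Gᴴ = diagonal (fun i => (w i : ℂ))) {i : ι} (hi : w i = 0) (y : Y) : G i y = 0 := by
  have h1 := congrFun (congrFun hG i) i
  simp only [diagonal_apply_eq, hi, Matrix.mul_apply, conjTranspose_apply] at h1
  have h2 : ∑ y, ‖G i y‖ ^ 2 = 0 := by
    have : ((∑ y, ‖G i y‖ ^ 2 : ℝ) : ℂ) = 0 := by
      push_cast
      rw [← Complex.ofReal_zero, ← h1]
      exact Finset.sum_congr rfl fun y _ => (Complex.mul_conj' _).symm
    exact_mod_cast this
  have := (Finset.sum_eq_zero_iff_of_nonneg (fun _ _ => by positivity)).1 h2 y (Finset.mem_univ _)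
  simpa using this

/-- The singular value form of a Schmidt decomposition. -/
theorem HasSchmidt.exists_contractions {W : Matrix X Y ℂ} {w : ι → ℝ} (h : HasSchmidt W w) :
    ∃ (E : Matrix X ι ℂ) (F : Matrix ι Y ℂ), ‖E‖ ≤ 1 ∧ ‖F‖ ≤ 1 ∧
      W = E * diagonal (fun i => ((√(w i) : ℝ) : ℂ)) * F := by
  have h0 := h.nonneg
  obtain ⟨E, G, hE, hG, hW⟩ := h
  have hrow := fun i => row_eq_zero hG (i := i)
  -- At `w i = 0` the inverse is `0`, so `F` is only a contraction; the factorization survives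
  -- because that row of `G` vanishes.
  refine ⟨E, diagonal (fun i => (((√(w i))⁻¹ : ℝ) : ℂ)) * G, ?_, ?_, ?_⟩
  · exact norm_le_one_of_conjTranspose_mul_self_le_one hE.le
  · rw [← l2_opNorm_conjTranspose]
    refine norm_le_one_of_conjTranspose_mul_self_le_one ?_
    rw [conjTranspose_conjTranspose, conjTranspose_mul, Matrix.mul_assoc, ← Matrix.mul_assoc G, hG,
      diagonal_conjTranspose, diagonal_mul_diagonal, diagonal_mul_diagonal, ← diagonal_one,
      Matrix.le_iff, diagonal_sub, posSemidef_diagonal_iff]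
    intro i
    have : (1 : ℂ) - (((√(w i))⁻¹ : ℝ) : ℂ) * ((w i : ℂ) * (star fun i => (((√(w i))⁻¹ : ℝ) : ℂ)) i)
        = ((1 - (√(w i))⁻¹ * (w i * (√(w i))⁻¹) : ℝ) : ℂ) := by
      simp
    rw [this]
    have h3 : (√(w i))⁻¹ * (w i * (√(w i))⁻¹) ≤ 1 := by
      rcases (h0 i).eq_or_lt with hi | hi
      · simp [← hi]
      · have := Real.sqrt_pos.2 hi
        have h4 := Real.mul_self_sqrt hi.le
        field_simp
        nlinarith
    exact_mod_cast sub_nonneg.2 h3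
  · rw [hW, Matrix.mul_assoc, ← Matrix.mul_assoc (diagonal _), diagonal_mul_diagonal]
    congr 1
    ext i y
    rw [diagonal_mul]
    rcases (h0 i).eq_or_lt with hi | hi
    · simp [hrow i hi.symm]
    · have := (Real.sqrt_pos.2 hi).ne'
      rw [← Complex.ofReal_mul, mul_inv_cancel₀ this]; simp

/-- Every bipartite vector has a Schmidt decomposition, given by the spectrum of `W * Wᴴ`. -/
theorem hasSchmidt_eigenvalues (W : Matrix X Y ℂ) (h : (W * Wᴴ).IsHermitian) :
    HasSchmidt W h.eigenvalues := by
  have hu := h.eigenvectorUnitary.2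
  set U : Matrix X X ℂ := (h.eigenvectorUnitary : Matrix X X ℂ) with hU
  have h1 : Uᴴ * U = 1 := (Unitary.mem_iff.1 hu).1
  have h2 : U * Uᴴ = 1 := (Unitary.mem_iff.1 hu).2
  refine ⟨U, Uᴴ * W, h1, ?_, ?_⟩
  · have h3 : W * Wᴴ = U * diagonal (fun i => (h.eigenvalues i : ℂ)) * Uᴴ := by
      have h4 := h.spectral_theorem
      rwa [Unitary.conjStarAlgAut_apply] at h4
    rw [conjTranspose_mul, conjTranspose_conjTranspose, ← Matrix.mul_assoc, Matrix.mul_assoc Uᴴ]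
    generalize (fun i => (h.eigenvalues i : ℂ)) = D at h3 ⊢
    rw [h3, ← Matrix.mul_assoc, ← Matrix.mul_assoc, h1, Matrix.one_mul, Matrix.mul_assoc, h1,
      Matrix.mul_one]
  · rw [← Matrix.mul_assoc, h2, Matrix.one_mul]

/-- By cyclicity of the trace, only the diagonal of `V` in the Schmidt bases matters; this lets an
overlap be split according to the size of the Schmidt coefficients. -/
theorem overlap_eq_sum {E : Matrix X ι ℂ} {F : Matrix ι Y ℂ} {s : ι → ℝ} (V : Matrix X Y ℂ) :
    overlap (E * diagonal (fun i => (s i : ℂ)) * F) V = ∑ i, (s i : ℂ) * (Eᴴ * V * Fᴴ) i i := by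
  rw [overlap_eq_trace, conjTranspose_mul, conjTranspose_mul, diagonal_conjTranspose,
    Matrix.mul_assoc, Matrix.trace_mul_comm, Matrix.mul_assoc, Matrix.mul_assoc, ← Matrix.mul_assoc Eᴴ]
  simp [trace, diagonal_mul]

theorem norm_sum_diag_le (S : Matrix ι ι ℂ) (w : ι → ℝ) (hw : ∀ i, 0 ≤ w i) (s : Finset ι) :
    ‖∑ i ∈ s, ((√(w i) : ℝ) : ℂ) * S i i‖ ≤ √(∑ i ∈ s, w i) * √(frobSq S) := by
  calc _ ≤ ∑ i ∈ s, √(w i) * ‖S i i‖ := by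
        refine (norm_sum_le _ _).trans (Finset.sum_le_sum fun i _ => ?_)
        rw [norm_mul, Complex.norm_real, Real.norm_of_nonneg (Real.sqrt_nonneg _)]
    _ ≤ √(∑ i ∈ s, √(w i) ^ 2) * √(∑ i ∈ s, ‖S i i‖ ^ 2) := Real.sum_mul_le_sqrt_mul_sqrt _ _ _
    _ ≤ _ := by
        refine mul_le_mul (le_of_eq ?_) (Real.sqrt_le_sqrt ?_) (Real.sqrt_nonneg _)
          (Real.sqrt_nonneg _)
        · congr 1; exact Finset.sum_congr rfl fun i _ => Real.sq_sqrt (hw i)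
        · calc _ ≤ ∑ i, ‖S i i‖ ^ 2 :=
                Finset.sum_le_sum_of_subset_of_nonneg (Finset.subset_univ _)
                  fun _ _ _ => by positivity
            _ ≤ _ := Finset.sum_le_sum fun i _ =>
                Finset.single_le_sum (f := fun j => ‖S i j‖ ^ 2) (fun _ _ => by positivity)
                  (Finset.mem_univ i)

theorem frobSq_conj_le {E : Matrix X ι ℂ} {F : Matrix ι Y ℂ} (hE : ‖E‖ ≤ 1) (hF : ‖F‖ ≤ 1)
    (V : Matrix X Y ℂ) : frobSq (Eᴴ * V * Fᴴ) ≤ frobSq V := by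
  refine (frobSq_mul_le_right _ _).trans ?_
  rw [l2_opNorm_conjTranspose]
  have h1 := frobSq_mul_le_left Eᴴ V
  rw [l2_opNorm_conjTranspose] at h1
  have h2 : ‖E‖ ^ 2 ≤ 1 := pow_le_one₀ (norm_nonneg _) hE
  have h3 : ‖F‖ ^ 2 ≤ 1 := pow_le_one₀ (norm_nonneg _) hF
  have h4 := frobSq_nonneg V
  have h5 := frobSq_nonneg (Eᴴ * V)
  nlinarith

/-- For contractions `A`, `B`, the vector `d^{-1/2} A * B` has small overlap with the parts of a
vector whose Schmidt coefficients are far from `d^{-1/2}`. -/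
theorem norm_overlap_le_of_contractions {d : ℕ} (hd : 0 < d) {W : Matrix X Y ℂ} {w : ι → ℝ}
    (hW : HasSchmidt W w) (hw : ∑ i, w i ≤ 1) {A : Matrix X (Fin d) ℂ} {B : Matrix (Fin d) Y ℂ}
    (hA : ‖A‖ ≤ 1) (hB : ‖B‖ ≤ 1) {l h : ℝ} (hh : 0 < h) (hlh : l ≤ h) :
    ‖overlap W ((((√(d : ℝ))⁻¹ : ℝ) : ℂ) • (A * B))‖ ≤ 1 / √(d * h) + √(d * l) +
      √(∑ i with l ≤ w i ∧ w i ≤ h, w i) *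
        √(frobSq ((((√(d : ℝ))⁻¹ : ℝ) : ℂ) • (A * B))) := by
  have h0 := hW.nonneg
  obtain ⟨E, F, hE, hF, rfl⟩ := hW.exists_contractions
  set V := (((√(d : ℝ))⁻¹ : ℝ) : ℂ) • (A * B) with hV
  have hd' : (0 : ℝ) < d := by exact_mod_cast hd
  have hsd : 0 < √(d : ℝ) := Real.sqrt_pos.2 hd'
  rw [overlap_eq_sum]
  set N := Eᴴ * A with hN
  set N' := B * Fᴴ with hN'
  have hN1 : ‖N‖ ≤ 1 := by
    refine (l2_opNorm_mul _ _).trans ?_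
    rw [l2_opNorm_conjTranspose]
    exact mul_le_one₀ hE (norm_nonneg _) hA
  have hN'1 : ‖N'‖ ≤ 1 := by
    refine (l2_opNorm_mul _ _).trans ?_
    rw [l2_opNorm_conjTranspose]
    exact mul_le_one₀ hB (norm_nonneg _) hF
  have hrow : ∀ i, ∑ j, ‖N i j‖ ^ 2 ≤ 1 := fun i =>
    (sum_norm_row_sq_le N i).trans (pow_le_one₀ (norm_nonneg _) hN1)
  have hrow' : ∀ i, ∑ j, ‖N' j i‖ ^ 2 ≤ 1 := fun i =>
    (sum_norm_col_sq_le N' i).trans (pow_le_one₀ (norm_nonneg _) hN'1)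
  have hall : ∑ i, ∑ j, ‖N i j‖ ^ 2 ≤ d := by
    rw [Finset.sum_comm]
    refine (Finset.sum_le_sum fun j _ => (sum_norm_col_sq_le N j).trans
      (pow_le_one₀ (norm_nonneg _) hN1)).trans ?_
    simp
  have hall' : ∑ i, ∑ j, ‖N' j i‖ ^ 2 ≤ d := by
    rw [Finset.sum_comm]
    refine (Finset.sum_le_sum fun j _ => (sum_norm_row_sq_le N' j).trans
      (pow_le_one₀ (norm_nonneg _) hN'1)).trans ?_
    simp
  have hS : ∀ i, ‖(Eᴴ * V * Fᴴ) i i‖ ≤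
      (√(d : ℝ))⁻¹ * (√(∑ j, ‖N i j‖ ^ 2) * √(∑ j, ‖N' j i‖ ^ 2)) := by
    intro i
    have e : Eᴴ * V * Fᴴ = (((√(d : ℝ))⁻¹ : ℝ) : ℂ) • (N * N') := by
      simp [hV, hN, hN', Matrix.mul_assoc]
    rw [e, Matrix.smul_apply, norm_smul, Complex.norm_real, Real.norm_of_nonneg (by positivity),
      Matrix.mul_apply]
    gcongr
    refine (norm_sum_le _ _).trans ?_
    simp only [norm_mul]
    exact Real.sum_mul_le_sqrt_mul_sqrt _ _ _
  have hnt : ∀ i, ‖((√(w i) : ℝ) : ℂ) * (Eᴴ * V * Fᴴ) i i‖ = √(w i) * ‖(Eᴴ * V * Fᴴ) i i‖ := by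
    intro i
    rw [norm_mul, Complex.norm_real, Real.norm_of_nonneg (Real.sqrt_nonneg _)]
  have hM : ‖∑ i with l ≤ w i ∧ w i ≤ h, ((√(w i) : ℝ) : ℂ) * (Eᴴ * V * Fᴴ) i i‖ ≤
      √(∑ i with l ≤ w i ∧ w i ≤ h, w i) * √(frobSq V) := by
    refine (norm_sum_diag_le _ w h0 _).trans ?_
    gcongr
    exact frobSq_conj_le hE hF V
  -- Large coefficients: each diagonal entry is at most `d^{-1/2}`, and `√(w i) ≤ w i / √h` turns
  -- the sum into total weight.
  have hH : ‖∑ i with h < w i, ((√(w i) : ℝ) : ℂ) * (Eᴴ * V * Fᴴ) i i‖ ≤ 1 / √(d * h) := by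
    calc _ ≤ ∑ i with h < w i, w i * (1 / √(d * h)) := by
          refine (norm_sum_le _ _).trans (Finset.sum_le_sum fun i hi => ?_)
          have hi : h < w i := (Finset.mem_filter.1 hi).2
          rw [hnt]
          have h1 : ‖(Eᴴ * V * Fᴴ) i i‖ ≤ (√(d : ℝ))⁻¹ := by
            refine (hS i).trans (mul_le_of_le_one_right (by positivity) ?_)
            exact mul_le_one₀ (Real.sqrt_le_one.2 (hrow i)) (Real.sqrt_nonneg _)
              (Real.sqrt_le_one.2 (hrow' i))
          have h2 : √h ≤ √(w i) := Real.sqrt_le_sqrt hi.le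
          have h3 : 0 < √h := Real.sqrt_pos.2 hh
          have h4 := Real.mul_self_sqrt (h0 i)
          rw [Real.sqrt_mul hd'.le]
          calc _ ≤ √(w i) * (√(d : ℝ))⁻¹ := by gcongr
            _ ≤ √(w i) * (√(w i) / √h) * (√(d : ℝ))⁻¹ := by
              gcongr
              refine le_mul_of_one_le_right (Real.sqrt_nonneg _) ((one_le_div h3).2 h2)
            _ = _ := by
              rw [mul_div_assoc', h4]; field_simp
      _ = (∑ i with h < w i, w i) * (1 / √(d * h)) := by rw [Finset.sum_mul]
      _ ≤ _ := by
          refine mul_le_of_le_one_left (by positivity) (le_trans ?_ hw)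
          exact Finset.sum_le_sum_of_subset_of_nonneg (Finset.subset_univ _) fun i _ _ => h0 i
  -- Small coefficients: `√(w i) ≤ √l`, and by Cauchy–Schwarz the row and column norms contribute at
  -- most `d`, since `N` and `N'` are contractions through dimension `d`.
  have hL : ‖∑ i with w i < l, ((√(w i) : ℝ) : ℂ) * (Eᴴ * V * Fᴴ) i i‖ ≤ √(d * l) := by
    calc _ ≤ ∑ i with w i < l, √l * (√(d : ℝ))⁻¹ *
            (√(∑ j, ‖N i j‖ ^ 2) * √(∑ j, ‖N' j i‖ ^ 2)) := by
          refine (norm_sum_le _ _).trans (Finset.sum_le_sum fun i hi => ?_)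
          have hi : w i < l := (Finset.mem_filter.1 hi).2
          rw [hnt, mul_assoc]
          exact mul_le_mul (Real.sqrt_le_sqrt hi.le) (hS i) (norm_nonneg _) (Real.sqrt_nonneg _)
      _ ≤ ∑ i, √l * (√(d : ℝ))⁻¹ * (√(∑ j, ‖N i j‖ ^ 2) * √(∑ j, ‖N' j i‖ ^ 2)) :=
          Finset.sum_le_sum_of_subset_of_nonneg (Finset.subset_univ _) fun i _ _ => by positivity
      _ = √l * (√(d : ℝ))⁻¹ * ∑ i, (√(∑ j, ‖N i j‖ ^ 2) * √(∑ j, ‖N' j i‖ ^ 2)) := by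
          rw [Finset.mul_sum]
      _ ≤ √l * (√(d : ℝ))⁻¹ * (√d * √d) := by
          gcongr
          refine (Real.sum_sqrt_mul_sqrt_le _ (fun i => by positivity)
            (fun i => by positivity)).trans ?_
          gcongr
      _ = _ := by
          rw [Real.sqrt_mul hd'.le]; field_simp
  have hsplit : ∀ g : ι → ℂ, ∑ i, g i = ∑ i with h < w i, g i + ∑ i with w i < l, g i +
      ∑ i with l ≤ w i ∧ w i ≤ h, g i := by
    intro g
    simp only [Finset.sum_filter, ← Finset.sum_add_distrib]
    refine Finset.sum_congr rfl fun i _ => ?_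
    rcases lt_or_ge h (w i) with h1 | h1
    · simp [h1, not_lt.2 (hlh.trans h1.le), not_le.2 h1]
    · rcases lt_or_ge (w i) l with h2 | h2
      · simp [not_lt.2 h1, h2, not_le.2 h2]
      · simp [not_lt.2 h1, not_lt.2 h2, h1, h2]
  rw [hsplit]
  exact (norm_add₃_le).trans (add_le_add (add_le_add hH hL) hM)

/-- A vector of Schmidt rank at most `d` overlaps little with the part of a vector that consists of
its small Schmidt coefficients. -/
theorem norm_overlap_le_of_rank {d : ℕ} {W : Matrix X Y ℂ} {w : ι → ℝ} (hW : HasSchmidt W w)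
    {V : Matrix X Y ℂ} (hV : V.rank ≤ d) {l : ℝ} (hl : 0 ≤ l) :
    ‖overlap W V‖ ≤ (√(∑ i with l < w i, w i) + √(d * l)) * √(frobSq V) := by
  have h0 := hW.nonneg
  obtain ⟨E, F, hE, hF, hWEF⟩ := hW.exists_contractions
  have hherm := isHermitian_mul_conjTranspose_self V
  have hv0 := (hasSchmidt_eigenvalues V hherm).nonneg
  have hvcard : (Finset.univ.filter fun i => hherm.eigenvalues i ≠ 0).card ≤ d := by
    rw [← rank_self_mul_conjTranspose, hherm.rank_eq_card_non_zero_eigs, Fintype.card_subtype] at hV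
    exact hV
  have hvsum : ∑ i, hherm.eigenvalues i = frobSq V := by
    have h1 := hherm.trace_eq_sum_eigenvalues
    have h2 : (V * Vᴴ).trace = ((frobSq V : ℝ) : ℂ) := by
      simp only [trace, Matrix.mul_apply, diag_apply, conjTranspose_apply, frobSq]
      push_cast
      exact Finset.sum_congr rfl fun x _ => Finset.sum_congr rfl fun y _ => Complex.mul_conj' _
    rw [h2] at h1
    apply Complex.ofReal_injective
    push_cast
    exact h1.symm
  obtain ⟨E', F', hE', hF', hVEF⟩ := (hasSchmidt_eigenvalues V hherm).exists_contractions
  generalize hherm.eigenvalues = v at *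
  -- Keeping only the small coefficients leaves a matrix `WL` of operator norm at most `√l`.
  set s : ι → ℝ := fun i => if l < w i then 0 else √(w i) with hs
  set WL := E * diagonal (fun i => (s i : ℂ)) * F with hWL
  have hLnorm : ‖WL‖ ≤ √l := by
    have h1 : ‖diagonal (fun i => (s i : ℂ))‖ ≤ √l := by
      rw [l2_opNorm_diagonal, pi_norm_le_iff_of_nonneg (Real.sqrt_nonneg _)]
      intro i
      rw [Complex.norm_real]
      by_cases hi : l < w i
      · simp [hs, hi]
      · simp only [hs, hi, if_false]
        rw [Real.norm_of_nonneg (Real.sqrt_nonneg _)]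
        exact Real.sqrt_le_sqrt (not_lt.1 hi)
    calc ‖WL‖ ≤ ‖E‖ * ‖diagonal (fun i => (s i : ℂ))‖ * ‖F‖ :=
          (l2_opNorm_mul _ _).trans (mul_le_mul_of_nonneg_right (l2_opNorm_mul _ _) (norm_nonneg _))
      _ ≤ 1 * √l * 1 := by gcongr
      _ = √l := by ring
  -- In the Schmidt bases of `V`, the overlap with `WL` has at most `d` non-zero terms.
  set S := E'ᴴ * WL * F'ᴴ with hS
  have hSnorm : ‖S‖ ≤ √l := by
    calc ‖S‖ ≤ ‖E'ᴴ‖ * ‖WL‖ * ‖F'ᴴ‖ :=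
          (l2_opNorm_mul _ _).trans (mul_le_mul_of_nonneg_right (l2_opNorm_mul _ _) (norm_nonneg _))
      _ ≤ 1 * √l * 1 := by
          rw [l2_opNorm_conjTranspose, l2_opNorm_conjTranspose]; gcongr
      _ = √l := by ring
  have hSdiag : ∀ j, ‖S j j‖ ^ 2 ≤ l := by
    intro j
    calc ‖S j j‖ ^ 2 ≤ ∑ k, ‖S j k‖ ^ 2 :=
          Finset.single_le_sum (f := fun k => ‖S j k‖ ^ 2) (fun _ _ => by positivity)
            (Finset.mem_univ j)
      _ ≤ ‖S‖ ^ 2 := sum_norm_row_sq_le S j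
      _ ≤ √l ^ 2 := by gcongr
      _ = l := Real.sq_sqrt hl
  have hLo : ‖overlap V WL‖ ≤ √(d * l) * √(frobSq V) := by
    conv_lhs => rw [hVEF]
    rw [overlap_eq_sum, ← hS]
    calc _ ≤ ∑ j, √(v j) * ‖S j j‖ := by
          refine (norm_sum_le _ _).trans (Finset.sum_le_sum fun i _ => ?_)
          rw [norm_mul, Complex.norm_real, Real.norm_of_nonneg (Real.sqrt_nonneg _)]
      _ = ∑ j with v j ≠ 0, √(v j) * ‖S j j‖ := by
          rw [Finset.sum_filter]
          refine Finset.sum_congr rfl fun j _ => ?_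
          by_cases hj : v j = 0 <;> simp [hj]
      _ ≤ √(∑ j with v j ≠ 0, √(v j) ^ 2) * √(∑ j with v j ≠ 0, ‖S j j‖ ^ 2) :=
          Real.sum_mul_le_sqrt_mul_sqrt _ _ _
      _ ≤ √(frobSq V) * √(d * l) := by
          gcongr
          · rw [← hvsum]
            simp only [Real.sq_sqrt (hv0 _)]
            exact Finset.sum_le_sum_of_subset_of_nonneg (Finset.subset_univ _) fun i _ _ => hv0 i
          · refine (Finset.sum_le_card_nsmul _ _ l fun j _ => hSdiag j).trans ?_
            rw [nsmul_eq_mul]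
            gcongr
      _ = _ := mul_comm _ _
  have hconj : overlap WL V = star (overlap V WL) := by
    simp [overlap, mul_comm]
  have hHo : ‖∑ i with l < w i, ((√(w i) : ℝ) : ℂ) * (Eᴴ * V * Fᴴ) i i‖ ≤
      √(∑ i with l < w i, w i) * √(frobSq V) := by
    refine (norm_sum_diag_le _ w h0 _).trans ?_
    gcongr
    exact frobSq_conj_le hE hF V
  have hsplit : overlap W V =
      ∑ i with l < w i, ((√(w i) : ℝ) : ℂ) * (Eᴴ * V * Fᴴ) i i + overlap WL V := by
    rw [hWEF, hWL, overlap_eq_sum, overlap_eq_sum, Finset.sum_filter, ← Finset.sum_add_distrib]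
    refine Finset.sum_congr rfl fun i _ => ?_
    by_cases hi : l < w i <;> simp [hs, hi]
  rw [hsplit, add_mul]
  refine (norm_add_le _ _).trans (add_le_add hHo ?_)
  rw [hconj, norm_star]
  exact hLo

end

/-! ### Protocols as sums of local products, and fidelity -/

section
open Matrix
open scoped ComplexOrder

theorem sum_conj_mul_conj {X Y Z : Type} [Fintype X] [Fintype Y] [Fintype Z]
    {R : Type} [Fintype R] {U : Matrix Y Z ℂ} (K : R → Matrix X Y ℂ) :
    ∑ r, (K r * U)ᴴ * (K r * U) = Uᴴ * (∑ r, (K r)ᴴ * K r) * U := by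
  simp only [conjTranspose_mul, Matrix.mul_sum, Matrix.sum_mul, Matrix.mul_assoc]

/-- Trace non-increasing maps compose; this carries the bound on the local Kraus operators through
the recursion over a protocol. -/
theorem sum_prod_conj_mul_le_one {X Y Z K R : Type} [Fintype X] [Fintype Y] [Fintype Z]
    [DecidableEq Y] [DecidableEq Z] [Fintype K] [Fintype R] {A : K → Matrix X Y ℂ}
    {U : R → Matrix Y Z ℂ} (hA : ∑ k, (A k)ᴴ * A k ≤ 1) (hU : ∑ r, (U r)ᴴ * U r ≤ 1) :
    ∑ x : K × R, (A x.1 * U x.2)ᴴ * (A x.1 * U x.2) ≤ 1 := by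
  rw [Fintype.sum_prod_type_right]
  refine le_trans (Finset.sum_le_sum fun r _ => ?_) hU
  dsimp only
  rw [sum_conj_mul_conj]
  have h := (Matrix.le_iff.1 hA).conjTranspose_mul_mul_same (U r)
  rw [Matrix.le_iff]
  simpa [Matrix.mul_sub, Matrix.sub_mul] using h

theorem Instrument.sum_kraus_le_one {X : Type} [Fintype X] [DecidableEq X] {Y : Bool → Type}
    [∀ m, Fintype (Y m)] (I : Instrument X Y) (m : Bool) :
    ∑ k, (I.kraus m k)ᴴ * I.kraus m k ≤ 1 := by
  rw [← I.complete]
  refine Finset.single_le_sum (f := fun m => ∑ k, (I.kraus m k)ᴴ * I.kraus m k)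
    (fun m _ => ?_) (Finset.mem_univ m)
  exact Finset.sum_nonneg fun k _ => (posSemidef_conjTranspose_mul_self _).nonneg

/-- On success, a protocol with `c` bits of communication acts as a sum of at most `2 ^ c` products
of local trace non-increasing maps. -/
theorem Protocol.exists_kraus {X Y : Type} [Fintype X] [Fintype Y] [DecidableEq X] [DecidableEq Y]
    {a b c : ℕ} (P : Protocol X Y a b c) :
    ∃ (T : Type) (_ : Fintype T) (K L : T → Type) (_ : ∀ t, Fintype (K t))
      (_ : ∀ t, Fintype (L t)) (A : (t : T) → K t → Matrix X (Fin a) ℂ)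
      (B : (t : T) → L t → Matrix Y (Fin b) ℂ),
      Fintype.card T ≤ 2 ^ c ∧ (∀ t, ∑ k, (A t k)ᴴ * A t k ≤ 1) ∧
      (∀ t, ∑ k, (B t k)ᴴ * B t k ≤ 1) ∧
      ∀ ρ, P.run ρ = ∑ t, ∑ k, ∑ l, (A t k ⊗ₖ B t l) * ρ * (A t k ⊗ₖ B t l)ᴴ := by
  induction P with
  | @done a b c opA opB =>
    refine ⟨Unit, inferInstance, fun _ => Fin (opA.num true), fun _ => Fin (opB.num true),
      fun _ => inferInstance, fun _ => inferInstance, fun _ => opA.kraus true,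
      fun _ => opB.kraus true, ?_, fun _ => opA.sum_kraus_le_one true,
      fun _ => opB.sum_kraus_le_one true, fun ρ => ?_⟩
    · simpa using Nat.one_le_two_pow
    · simp only [Protocol.run, Instrument.applyA, Instrument.applyB, Finset.univ_unique,
        Finset.sum_singleton, Matrix.mul_sum, Matrix.sum_mul]
      rw [Finset.sum_comm]
      refine Finset.sum_congr rfl fun k _ => Finset.sum_congr rfl fun l _ => ?_
      have e : opA.kraus true k ⊗ₖ opB.kraus true l =
          ((1 : Matrix X X ℂ) ⊗ₖ opB.kraus true l) * (opA.kraus true k ⊗ₖ (1 : Matrix (Fin b) (Fin b) ℂ)) := by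
        rw [← mul_kronecker_mul, Matrix.one_mul, Matrix.mul_one]
      rw [e, conjTranspose_mul]
      simp only [Matrix.mul_assoc]
  | @alice a b c a' I next ih =>
    choose T iT K L iK iL A B hT hA hB hrun using ih
    -- Only the bit `m` that is sent enlarges the transcript; the Kraus index of the instrument
    -- stays private to the party that applied it.
    refine ⟨Σ m, T m, inferInstance, fun t => K t.1 t.2 × Fin (I.num t.1), fun t => L t.1 t.2,
      fun _ => inferInstance, fun _ => inferInstance, fun t k => A t.1 t.2 k.1 * I.kraus t.1 k.2,
      fun t => B t.1 t.2, ?_, fun t => ?_, fun t => hB _ _, fun ρ => ?_⟩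
    · rw [Fintype.card_sigma]
      refine (Finset.sum_le_sum fun m _ => hT m).trans ?_
      simp [pow_succ, mul_comm]
    · exact sum_prod_conj_mul_le_one (hA _ _) (I.sum_kraus_le_one _)
    · simp only [Protocol.run, hrun, Instrument.applyA, Matrix.mul_sum, Matrix.sum_mul]
      rw [Fintype.sum_sigma]
      refine Finset.sum_congr rfl fun m _ => Finset.sum_congr rfl fun t _ => ?_
      rw [Fintype.sum_prod_type]
      refine Finset.sum_congr rfl fun k _ => ?_
      rw [Finset.sum_comm]
      refine Finset.sum_congr rfl fun r _ => Finset.sum_congr rfl fun l _ => ?_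
      have e : (A m t k * I.kraus m r) ⊗ₖ B m t l =
          (A m t k ⊗ₖ B m t l) * (I.kraus m r ⊗ₖ (1 : Matrix (Fin b) (Fin b) ℂ)) := by
        rw [← mul_kronecker_mul, Matrix.mul_one]
      rw [e, conjTranspose_mul]
      simp only [Matrix.mul_assoc]
  | @bob a b c b' I next ih =>
    choose T iT K L iK iL A B hT hA hB hrun using ih
    refine ⟨Σ m, T m, inferInstance, fun t => K t.1 t.2, fun t => L t.1 t.2 × Fin (I.num t.1),
      fun _ => inferInstance, fun _ => inferInstance, fun t => A t.1 t.2,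
      fun t k => B t.1 t.2 k.1 * I.kraus t.1 k.2,
      ?_, fun t => hA _ _, fun t => ?_, fun ρ => ?_⟩
    · rw [Fintype.card_sigma]
      refine (Finset.sum_le_sum fun m _ => hT m).trans ?_
      simp [pow_succ, mul_comm]
    · exact sum_prod_conj_mul_le_one (hB _ _) (I.sum_kraus_le_one _)
    · simp only [Protocol.run, hrun, Instrument.applyB, Matrix.mul_sum, Matrix.sum_mul]
      rw [Fintype.sum_sigma]
      refine Finset.sum_congr rfl fun m _ => Finset.sum_congr rfl fun t _ => ?_
      refine Finset.sum_congr rfl fun k _ => ?_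
      rw [Fintype.sum_prod_type]
      refine Finset.sum_congr rfl fun l _ => Finset.sum_congr rfl fun r _ => ?_
      have e : A m t k ⊗ₖ (B m t l * I.kraus m r) =
          (A m t k ⊗ₖ B m t l) * ((1 : Matrix (Fin a) (Fin a) ℂ) ⊗ₖ I.kraus m r) := by
        rw [← mul_kronecker_mul, Matrix.mul_one]
      rw [e, conjTranspose_mul]
      simp only [Matrix.mul_assoc]

/-- The amplitude matrix of `(A ⊗ B)|Φ_d⟩`. -/
def branch {X Y : Type} {d : ℕ} (A : Matrix X (Fin d) ℂ) (B : Matrix Y (Fin d) ℂ) :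
    Matrix X Y ℂ :=
  (((√(d : ℝ))⁻¹ : ℝ) : ℂ) • (A * Bᵀ)

theorem kronecker_mulVec_maxEntangled {X Y : Type} {d : ℕ} (A : Matrix X (Fin d) ℂ)
    (B : Matrix Y (Fin d) ℂ) (x : X) (y : Y) :
    ((A ⊗ₖ B) *ᵥ maxEntangled d) (x, y) = branch A B x y := by
  simp only [mulVec, dotProduct, maxEntangled, Fintype.sum_prod_type, kronecker_apply, branch,
    Matrix.smul_apply, Matrix.mul_apply, transpose_apply, mul_ite, mul_zero, Finset.sum_ite_eq,
    Finset.mem_univ, if_true, smul_eq_mul, Finset.mul_sum]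
  exact Finset.sum_congr rfl fun _ _ => mul_comm _ _

theorem mul_pureState_mul {X Z : Type} [Fintype X] [Fintype Z] (M : Matrix Z X ℂ) (v : X → ℂ) :
    M * pureState v * Mᴴ = pureState (M *ᵥ v) := by
  rw [pureState, pureState, mul_vecMulVec, vecMulVec_mul, star_mulVec]

theorem trace_pureState {X Y : Type} [Fintype X] [Fintype Y] (v : X × Y → ℂ) (V : Matrix X Y ℂ)
    (h : ∀ x y, v (x, y) = V x y) : (pureState v).trace = (frobSq V : ℂ) := by
  simp only [trace, diag_apply, pureState, vecMulVec_apply, Fintype.sum_prod_type, h, frobSq,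
    Pi.star_apply]
  push_cast
  exact Finset.sum_congr rfl fun x _ => Finset.sum_congr rfl fun y _ => Complex.mul_conj' _

theorem dotProduct_pureState {X Y : Type} [Fintype X] [Fintype Y] (u v : X × Y → ℂ)
    (U V : Matrix X Y ℂ) (hu : ∀ x y, u (x, y) = U x y) (hv : ∀ x y, v (x, y) = V x y) :
    star u ⬝ᵥ (pureState v *ᵥ u) = ((‖overlap U V‖ ^ 2 : ℝ) : ℂ) := by
  have e : star u ⬝ᵥ v = overlap U V := by
    simp [dotProduct, Fintype.sum_prod_type, overlap, hu, hv]
  have e2 : star v ⬝ᵥ u = star (overlap U V) := by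
    rw [← e, star_dotProduct]
  rw [pureState, vecMulVec_mulVec, dotProduct_smul, e, e2]
  push_cast
  simpa using Complex.mul_conj' (overlap U V)

/-- The quantities of a protocol run on `|Φ_d⟩` in terms of the amplitude matrices of its
branches. -/
theorem run_maxEntangled {X Y T : Type} [Fintype X] [Fintype Y] [DecidableEq X] [DecidableEq Y]
    [Fintype T] {K L : T → Type} [∀ t, Fintype (K t)] [∀ t, Fintype (L t)] {d c : ℕ}
    {P : Protocol X Y d d c}
    {A : (t : T) → K t → Matrix X (Fin d) ℂ} {B : (t : T) → L t → Matrix Y (Fin d) ℂ}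
    (h : ∀ ρ, P.run ρ = ∑ t, ∑ k, ∑ l, (A t k ⊗ₖ B t l) * ρ * (A t k ⊗ₖ B t l)ᴴ) :
    P.successProb (pureState (maxEntangled d)) =
      ∑ t, ∑ k, ∑ l, frobSq (branch (A t k) (B t l)) ∧
    ∀ (u : X × Y → ℂ) (U : Matrix X Y ℂ), (∀ x y, u (x, y) = U x y) →
      star u ⬝ᵥ (P.run (pureState (maxEntangled d)) *ᵥ u) =
        ((∑ t, ∑ k, ∑ l, ‖overlap U (branch (A t k) (B t l))‖ ^ 2 : ℝ) : ℂ) := by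
  constructor
  · simp only [Protocol.successProb, h, mul_pureState_mul, trace_sum]
    simp only [trace_pureState _ _ (kronecker_mulVec_maxEntangled _ _)]
    rw [← Complex.ofReal_re (∑ t, _)]
    push_cast
    rfl
  · intro u U hu
    simp only [h, mul_pureState_mul, sum_mulVec, dotProduct_sum]
    simp only [dotProduct_pureState u _ U _ hu (kronecker_mulVec_maxEntangled _ _)]
    push_cast
    rfl

theorem Protocol.posSemidef_run {X Y : Type} [Fintype X] [Fintype Y] [DecidableEq X] [DecidableEq Y]
    {a b c : ℕ} (P : Protocol X Y a b c) {ρ : Matrix (Fin a × Fin b) (Fin a × Fin b) ℂ}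
    (hρ : ρ.PosSemidef) : (P.run ρ).PosSemidef := by
  obtain ⟨T, _, K, L, _, _, A, B, -, -, -, h⟩ := P.exists_kraus
  rw [h]
  exact posSemidef_sum _ fun t _ => posSemidef_sum _ fun k _ => posSemidef_sum _ fun l _ =>
    hρ.mul_mul_conjTranspose_same _

theorem posSemidef_pureState {X : Type} [Fintype X] (v : X → ℂ) : (pureState v).PosSemidef :=
  posSemidef_vecMulVec_self_star v

/-- A positive matrix has expectation at most its trace in any unit vector. -/
theorem dotProduct_mulVec_le_trace {X : Type} [Fintype X] [DecidableEq X] {M : Matrix X X ℂ}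
    (hM : M.PosSemidef) {u : X → ℂ} (hu : ∑ x, ‖u x‖ ^ 2 = 1) :
    (star u ⬝ᵥ (M *ᵥ u)).re ≤ M.trace.re := by
  obtain ⟨N, rfl⟩ : ∃ N : Matrix X X ℂ, M = Nᴴ * N := by
    exact (CStarAlgebra.nonneg_iff_eq_star_mul_self).1 hM.nonneg
  have e1 : star u ⬝ᵥ ((Nᴴ * N) *ᵥ u) = ((∑ x, ‖(N *ᵥ u) x‖ ^ 2 : ℝ) : ℂ) := by
    rw [← mulVec_mulVec, dotProduct_mulVec, ← star_mulVec]
    simp only [dotProduct, Pi.star_apply]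
    push_cast
    exact Finset.sum_congr rfl fun x _ => Complex.conj_mul' _
  have e2 : (Nᴴ * N).trace = ((∑ x, ∑ y, ‖N x y‖ ^ 2 : ℝ) : ℂ) := by
    simp only [trace, diag_apply, Matrix.mul_apply, conjTranspose_apply]
    rw [Finset.sum_comm]
    push_cast
    exact Finset.sum_congr rfl fun x _ => Finset.sum_congr rfl fun y _ => Complex.conj_mul' _
  rw [e1, e2, Complex.ofReal_re, Complex.ofReal_re]
  refine Finset.sum_le_sum fun x _ => ?_
  calc ‖(N *ᵥ u) x‖ ^ 2 ≤ (∑ y, ‖N x y‖ * ‖u y‖) ^ 2 := by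
        gcongr
        refine (norm_sum_le _ _).trans ?_
        simp
    _ ≤ (∑ y, ‖N x y‖ ^ 2) * ∑ y, ‖u y‖ ^ 2 := Finset.sum_mul_sq_le_sq_mul_sq _ _ _
    _ = _ := by rw [hu, mul_one]

/-- The fidelity with a pure state is at least `1 - ε` at trace distance `ε`. -/
theorem one_sub_traceDist_le {X : Type} [Fintype X] [DecidableEq X] {σ : Matrix X X ℂ}
    (hσ : σ.IsHermitian) {u : X → ℂ} (hu : ∑ x, ‖u x‖ ^ 2 = 1) :
    1 - traceDist σ (pureState u) ≤ (star u ⬝ᵥ (σ *ᵥ u)).re := by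
  have hΔ : IsSelfAdjoint (σ - pureState u) := hσ.sub (isHermitian_pureState u)
  -- With `Δ = σ - |u⟩⟨u|`, positivity of `|Δ| + Δ = 2 Δ⁺` gives `⟨u|Δ|u⟩ ≥ -⟨u||Δ||u⟩ ≥ -Tr |Δ|`.
  have h1 : 0 ≤ CFC.abs (σ - pureState u) + (σ - pureState u) := by
    rw [CFC.abs_add_self _ hΔ]
    exact smul_nonneg (by norm_num) (CFC.posPart_nonneg _)
  have h2 := (Matrix.nonneg_iff_posSemidef.1 h1).re_dotProduct_nonneg u
  have h3 := dotProduct_mulVec_le_trace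
    (Matrix.nonneg_iff_posSemidef.1 (CFC.abs_nonneg (σ - pureState u))) hu
  have e : star u ⬝ᵥ (pureState u *ᵥ u) = 1 := by
    have e1 : star u ⬝ᵥ u = 1 := by
      rw [← Complex.ofReal_one, ← hu]
      simp only [dotProduct, Pi.star_apply]
      push_cast
      exact Finset.sum_congr rfl fun x _ => Complex.conj_mul' _
    rw [pureState, vecMulVec_mulVec, dotProduct_smul, e1]
    simp
  rw [add_mulVec, sub_mulVec, dotProduct_add, dotProduct_sub, e] at h2
  simp only [map_add, map_sub] at h2
  simp only [RCLike.re_to_complex, Complex.one_re] at h2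
  unfold traceDist
  linarith

end

/-! ### Moments and tails of sums of independent variables -/

/-- Expectation of a function of a sum of `n` independent copies of `f` under the weights `μ`. -/
def sumExp {ι : Type} [Fintype ι] (μ f : ι → ℝ) (n : ℕ) (g : ℝ → ℝ) : ℝ :=
  ∑ I : Fin n → ι, (∏ k, μ (I k)) * g (∑ k, f (I k))

section
variable {ι : Type} [Fintype ι] (μ f : ι → ℝ)

theorem sumExp_succ (n : ℕ) (g : ℝ → ℝ) :
    sumExp μ f (n + 1) g = ∑ i, μ i * sumExp μ f n (fun x => g (f i + x)) := by
  unfold sumExp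
  rw [← (Fin.consEquiv fun _ => ι).sum_comp, Fintype.sum_prod_type]
  refine Finset.sum_congr rfl fun i _ => ?_
  rw [Finset.mul_sum]
  refine Finset.sum_congr rfl fun I _ => ?_
  simp [Fin.prod_univ_succ, Fin.sum_univ_succ, Fin.consEquiv, mul_assoc]

theorem sumExp_add (n : ℕ) (g h : ℝ → ℝ) :
    sumExp μ f n (fun x => g x + h x) = sumExp μ f n g + sumExp μ f n h := by
  simp [sumExp, mul_add, Finset.sum_add_distrib]

theorem sumExp_const_mul (n : ℕ) (a : ℝ) (g : ℝ → ℝ) :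
    sumExp μ f n (fun x => a * g x) = a * sumExp μ f n g := by
  simp only [sumExp, Finset.mul_sum]
  exact Finset.sum_congr rfl fun _ _ => by ring

theorem sumExp_const (h : ∑ i, μ i = 1) (n : ℕ) (a : ℝ) : sumExp μ f n (fun _ => a) = a := by
  have : ∑ I : Fin n → ι, ∏ k, μ (I k) = (∑ i, μ i) ^ n := by
    rw [Fintype.sum_pow]
  simp [sumExp, ← Finset.sum_mul, this, h]

variable {μ f}

theorem sumExp_id (hμ : ∑ i, μ i = 1) (hf : ∑ i, μ i * f i = 0) (n : ℕ) :
    sumExp μ f n (fun x => x) = 0 := by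
  induction n with
  | zero => simp [sumExp]
  | succ n ih =>
    have e : ∀ i, sumExp μ f n (fun x => f i + x) = f i := by
      intro i
      rw [sumExp_add, sumExp_const μ f hμ, ih, add_zero]
    simp only [sumExp_succ, e, hf]

theorem sumExp_sq (hμ : ∑ i, μ i = 1) (hf : ∑ i, μ i * f i = 0) (n : ℕ) :
    sumExp μ f n (fun x => x ^ 2) = n * ∑ i, μ i * f i ^ 2 := by
  induction n with
  | zero => simp [sumExp]
  | succ n ih =>
    have e : ∀ i, sumExp μ f n (fun x => (f i + x) ^ 2) =
        f i ^ 2 + n * ∑ i, μ i * f i ^ 2 := by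
      intro i
      have : (fun x => (f i + x) ^ 2) = fun x => (f i ^ 2 + (2 * f i) * x) + x ^ 2 := by
        ext x; ring
      rw [this, sumExp_add, sumExp_add, sumExp_const_mul, sumExp_const μ f hμ, sumExp_id hμ hf, ih]
      ring
    simp only [sumExp_succ, e, mul_add, Finset.sum_add_distrib, ← Finset.sum_mul, hμ]
    push_cast
    ring

/-- Induction on `n` by the binomial expansion. The third moment of the sum need not be computed,
because it is multiplied by the mean of `f`, which is zero. -/
theorem sumExp_pow_four (hμ : ∑ i, μ i = 1) (hf : ∑ i, μ i * f i = 0) (n : ℕ) :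
    sumExp μ f n (fun x => x ^ 4) =
    n * ∑ i, μ i * f i ^ 4 + 3 * n * (n - 1) * (∑ i, μ i * f i ^ 2) ^ 2 := by
  induction n with
  | zero => simp [sumExp]
  | succ n ih =>
    have e : ∀ i, sumExp μ f n (fun x => (f i + x) ^ 4) = f i ^ 4 +
        6 * f i ^ 2 * (n * ∑ i, μ i * f i ^ 2) + 4 * f i * sumExp μ f n (fun x => x ^ 3) +
        (n * ∑ i, μ i * f i ^ 4 + 3 * n * (n - 1) * (∑ i, μ i * f i ^ 2) ^ 2) := by
      intro i
      have : (fun x => (f i + x) ^ 4) = fun x => (((f i ^ 4 + (4 * f i ^ 3) * x) +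
          (6 * f i ^ 2) * x ^ 2) + (4 * f i) * x ^ 3) + x ^ 4 := by
        ext x; ring
      rw [this, sumExp_add, sumExp_add, sumExp_add, sumExp_add, sumExp_const_mul, sumExp_const_mul,
        sumExp_const_mul, sumExp_const μ f hμ, sumExp_id hμ hf, sumExp_sq hμ hf, ih]
      ring
    have e2 : ∀ c, ∑ i, μ i * (6 * f i ^ 2 * c) = 6 * c * ∑ i, μ i * f i ^ 2 := by
      intro c; rw [Finset.mul_sum]; exact Finset.sum_congr rfl fun _ _ => by ring
    have e3 : ∀ c, ∑ i, μ i * (4 * f i * c) = 4 * c * ∑ i, μ i * f i := by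
      intro c; rw [Finset.mul_sum]; exact Finset.sum_congr rfl fun _ _ => by ring
    simp only [sumExp_succ, e, mul_add, Finset.sum_add_distrib, e2, e3, hf, ← Finset.sum_mul, hμ]
    push_cast
    ring

end

/-- The polynomial equals `x (x + 2)² (4 - x) / 12`, so it is non-positive for `x ≤ 0`. The linear
term, invisible to a centred variable, singles out the right tail. -/
theorem quartic_le_of_lt {x : ℝ} (hx : x < 1 / 10) : 4 / 3 * x + x ^ 2 - x ^ 4 / 12 ≤ 3 / 20 := by
  rcases le_or_gt x 0 with h | h
  · nlinarith [mul_nonneg (neg_nonneg.2 h) (mul_nonneg (sq_nonneg (x + 2)) (by linarith : 0 ≤ 4 - x))]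
  · nlinarith [sq_nonneg (x ^ 2)]

/-- The maximum is at `1 + √3`, approximated in the hints by `2.73` with square `7.46`. -/
theorem quartic_le (x : ℝ) : 4 / 3 * x + x ^ 2 - x ^ 4 / 12 ≤ 13 / 2 := by
  nlinarith [sq_nonneg (x ^ 2 - 746 / 100), sq_nonneg (x - 273 / 100)]

/-- A centred random variable with controlled fourth moment exceeds a tenth of its standard
deviation with constant probability. -/
theorem one_div_thirteen_le_tail {ι : Type} [Fintype ι] {μ X : ι → ℝ} (h0 : ∀ i, 0 ≤ μ i)
    (h1 : ∑ i, μ i = 1) (hX : ∑ i, μ i * X i = 0) {b : ℝ} (hb : 0 < b)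
    (h2 : ∑ i, μ i * X i ^ 2 = b ^ 2) (h4 : ∑ i, μ i * X i ^ 4 ≤ 4 * (b ^ 2) ^ 2) :
    1 / 13 ≤ ∑ i with b / 10 ≤ X i, μ i := by
  -- The polynomial has mean at least `1 - 4 / 12 = 2 / 3`, so the tail has probability at least `(2
  -- / 3 - 3 / 20) / (13 / 2) = 31 / 390 > 1 / 13`.
  have key : ∀ i, μ i * (4 / 3 * (X i / b) + (X i / b) ^ 2 - (X i / b) ^ 4 / 12 - 3 / 20) ≤
      if b / 10 ≤ X i then 13 / 2 * μ i else 0 := by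
    intro i
    split_ifs with h
    · nlinarith [quartic_le (X i / b), h0 i]
    · have : X i / b < 1 / 10 := by
        rw [div_lt_iff₀ hb]; linarith
      nlinarith [quartic_le_of_lt this, h0 i]
  have hs := Finset.sum_le_sum fun i (_ : i ∈ Finset.univ) => key i
  rw [← Finset.sum_filter, ← Finset.mul_sum] at hs
  have e : ∑ i, μ i * (4 / 3 * (X i / b) + (X i / b) ^ 2 - (X i / b) ^ 4 / 12 - 3 / 20) =
      4 / 3 / b * ∑ i, μ i * X i + (b ^ 2)⁻¹ * ∑ i, μ i * X i ^ 2 -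
        (12 * (b ^ 2) ^ 2)⁻¹ * ∑ i, μ i * X i ^ 4 - 3 / 20 * ∑ i, μ i := by
    simp only [Finset.mul_sum, ← Finset.sum_add_distrib, ← Finset.sum_sub_distrib]
    refine Finset.sum_congr rfl fun i _ => ?_
    field_simp
  rw [e, hX, h2, h1, inv_mul_cancel₀ (by positivity)] at hs
  have h5 : (12 * (b ^ 2) ^ 2)⁻¹ * ∑ i, μ i * X i ^ 4 ≤ 1 / 3 := by
    rw [inv_mul_le_iff₀ (by positivity)]; linarith
  linarith

/-- Both tails of a sum of `n` i.i.d. centred variables, at distance `β √n`, have constant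
probability. -/
theorem exists_tails {ι : Type} [Fintype ι] {μ f : ι → ℝ} (h0 : ∀ i, 0 ≤ μ i)
    (hμ : ∑ i, μ i = 1) (hf : ∑ i, μ i * f i = 0) (hv : 0 < ∑ i, μ i * f i ^ 2) :
    ∃ β : ℝ, 0 < β ∧ ∃ n₀ : ℕ, ∀ n, n₀ ≤ n →
      1 / 13 ≤ ∑ I : Fin n → ι with β * √n ≤ ∑ k, f (I k), ∏ k, μ (I k) ∧
      1 / 13 ≤ ∑ I : Fin n → ι with ∑ k, f (I k) ≤ -(β * √n), ∏ k, μ (I k) := by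
  set v := ∑ i, μ i * f i ^ 2 with hvdef
  set m := ∑ i, μ i * f i ^ 4 with hm
  -- Beyond this `n` the single-variable fourth moments add at most `n² v²` to the Gaussian term `3
  -- n² v²`.
  obtain ⟨n₀, hn₀⟩ := exists_nat_ge (m / v ^ 2)
  refine ⟨√v / 10, by positivity, n₀ + 1, fun n hn => ?_⟩
  have hn0 : (0 : ℝ) < n := by exact_mod_cast (by omega : 0 < n)
  have hb : 0 < √v * √n := by positivity
  have hb2 : (√v * √n) ^ 2 = n * v := by
    rw [mul_pow, Real.sq_sqrt hv.le, Real.sq_sqrt hn0.le, mul_comm]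
  have hmn : m ≤ n * v ^ 2 := by
    rw [div_le_iff₀ (by positivity)] at hn₀
    refine hn₀.trans ?_
    gcongr
    omega
  have hp0 : ∀ I : Fin n → ι, 0 ≤ ∏ k, μ (I k) := fun I => Finset.prod_nonneg fun k _ => h0 _
  have e1 : ∑ I : Fin n → ι, ∏ k, μ (I k) = 1 := by
    simpa [sumExp] using sumExp_const μ f hμ n 1
  have ex : ∑ I : Fin n → ι, (∏ k, μ (I k)) * ∑ k, f (I k) = 0 := sumExp_id hμ hf n
  have e2 : ∑ I : Fin n → ι, (∏ k, μ (I k)) * (∑ k, f (I k)) ^ 2 = (√v * √n) ^ 2 := by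
    rw [hb2]; exact sumExp_sq hμ hf n
  have e4 : ∑ I : Fin n → ι, (∏ k, μ (I k)) * (∑ k, f (I k)) ^ 4 ≤ 4 * ((√v * √n) ^ 2) ^ 2 := by
    rw [hb2]
    refine (sumExp_pow_four hμ hf n).trans_le ?_
    rw [← hvdef, ← hm]
    nlinarith [mul_nonneg hn0.le (sub_nonneg.2 hmn), mul_pos hn0 (pow_pos hv 2)]
  constructor
  · refine (one_div_thirteen_le_tail hp0 e1 ex hb e2 e4).trans_eq ?_
    congr 1; ext I; simp only [Finset.mem_filter]; rw [mul_div_right_comm]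
  · refine (one_div_thirteen_le_tail (X := fun I => -∑ k, f (I k)) hp0 e1 (by simpa using ex) hb
      (by simpa using e2) (by simpa [Even.neg_pow (by decide : Even 4)] using e4)).trans_eq ?_
    congr 1; ext I; simp only [Finset.mem_filter]; rw [mul_div_right_comm, le_neg]

theorem sum_filter_le_of_disjoint {κ : Type} [Fintype κ] {μ : κ → ℝ} (h0 : ∀ i, 0 ≤ μ i)
    (hμ : ∑ i, μ i = 1) {p q : κ → Prop} [DecidablePred p] [DecidablePred q]
    (hpq : ∀ i, 0 < μ i → p i → ¬ q i) {t : ℝ} (hq : t ≤ ∑ i with q i, μ i) :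
    ∑ i with p i, μ i ≤ 1 - t := by
  have : ∑ i with p i, μ i + ∑ i with q i, μ i ≤ ∑ i, μ i := by
    simp only [Finset.sum_filter, ← Finset.sum_add_distrib]
    refine Finset.sum_le_sum fun i _ => ?_
    rcases (h0 i).eq_or_lt with h | h
    · simp [← h]
    · have := hpq i h
      by_cases hp : p i <;> by_cases hq : q i <;> simp_all
  linarith

/-- Non-uniform i.i.d. weights are neither concentrated on the values above `2 ^ -(n H + β √n)`,
where `H` is the entropy, nor on any window of values of logarithmic width below `2 β √n`. -/
theorem exists_anticoncentration {ι : Type} [Fintype ι] {μ : ι → ℝ} (h0 : ∀ i, 0 ≤ μ i)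
    (hμ : ∑ i, μ i = 1) {H : ℝ} (hH : H = -∑ i, μ i * Real.logb 2 (μ i))
    (hne : ∃ i, 0 < μ i ∧ Real.logb 2 (μ i) ≠ -H) :
    ∃ β : ℝ, 0 < β ∧ ∃ n₀ : ℕ, ∀ n, n₀ ≤ n →
      ∑ I : Fin n → ι with (2 : ℝ) ^ (-(n * H + β * √n)) < ∏ k, μ (I k), ∏ k, μ (I k) ≤ 12 / 13 ∧
      ∀ l h : ℝ, 0 < l → h < l * 2 ^ (2 * (β * √n)) →
        ∑ I : Fin n → ι with l ≤ ∏ k, μ (I k) ∧ ∏ k, μ (I k) ≤ h, ∏ k, μ (I k) ≤ 12 / 13 := by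
  -- The fluctuation of the information content, centred by the definition of `H`. The default `logb
  -- 2 0 = 0` is harmless, as such indices have weight zero.
  set f : ι → ℝ := fun i => -Real.logb 2 (μ i) - H with hf
  have hf0 : ∑ i, μ i * f i = 0 := by
    simp only [hf, mul_sub, mul_neg, Finset.sum_sub_distrib, Finset.sum_neg_distrib,
      ← Finset.sum_mul, hμ, one_mul]
    linarith
  have hv : 0 < ∑ i, μ i * f i ^ 2 := by
    obtain ⟨i, hi, hi'⟩ := hne
    refine Finset.sum_pos' (fun j _ => mul_nonneg (h0 j) (sq_nonneg _)) ⟨i, Finset.mem_univ _, ?_⟩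
    refine mul_pos hi (sq_pos_of_ne_zero fun h => hi' ?_)
    simp only [hf] at h
    linarith
  obtain ⟨β, hβ, n₀, hn₀⟩ := exists_tails h0 hμ hf0 hv
  refine ⟨β, hβ, n₀, fun n hn => ?_⟩
  obtain ⟨hU, hL⟩ := hn₀ n hn
  have hp0 : ∀ I : Fin n → ι, 0 ≤ ∏ k, μ (I k) := fun I => Finset.prod_nonneg fun k _ => h0 _
  have e1 : ∑ I : Fin n → ι, ∏ k, μ (I k) = 1 := by
    simpa [sumExp] using sumExp_const μ f hμ n 1
  have hlog : ∀ I : Fin n → ι, 0 < ∏ k, μ (I k) →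
      Real.logb 2 (∏ k, μ (I k)) = -(n * H + ∑ k, f (I k)) := by
    intro I hI
    have hne : ∀ k, μ (I k) ≠ 0 := fun k hk => hI.ne' (Finset.prod_eq_zero (Finset.mem_univ k) hk)
    rw [Real.logb_prod _ _ fun k _ => hne k]
    simp [hf, Finset.sum_sub_distrib]
  refine ⟨?_, fun l h hl hlh => ?_⟩
  · refine (sum_filter_le_of_disjoint hp0 e1 (fun I hI hI' hI'' => ?_) hU).trans (by norm_num)
    rw [← Real.lt_logb_iff_rpow_lt (by norm_num) hI, hlog I hI] at hI'
    linarith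
  -- The tails are `2 β √n` apart on the logarithmic scale, so a narrower window misses one: the
  -- tail of small weights if its lower end is high enough, else that of large weights.
  · by_cases hc : -(n * H + β * √n) < Real.logb 2 l
    · refine (sum_filter_le_of_disjoint hp0 e1 (fun I hI hI' hI'' => ?_) hU).trans (by norm_num)
      have h1 := Real.logb_le_logb_of_le (b := 2) (by norm_num) hl hI'.1
      rw [hlog I hI] at h1
      linarith
    · refine (sum_filter_le_of_disjoint hp0 e1 (fun I hI hI' hI'' => ?_) hL).trans (by norm_num)
      have h1 := Real.logb_lt_logb (b := 2) (by norm_num) hI (hI'.2.trans_lt hlh)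
      rw [hlog I hI, Real.logb_mul hl.ne' (by positivity), Real.logb_rpow (by norm_num)
        (by norm_num)] at h1
      linarith

/-! ### Tensor products and private Kraus indices -/

section
open Matrix
open scoped ComplexOrder Matrix.Norms.L2Operator

set_option linter.unusedSectionVars false

variable {X Y ι K L κ : Type} [Fintype X] [Fintype Y] [Fintype ι] [Fintype K] [Fintype L]
  [Fintype κ] [DecidableEq X] [DecidableEq Y] [DecidableEq ι] [DecidableEq K] [DecidableEq L]
  [DecidableEq κ]

theorem trace_conjTranspose_mul_self_eq_frobSq (W : Matrix X Y ℂ) :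
    (Wᴴ * W).trace = (frobSq W : ℂ) := by
  rw [← overlap_eq_trace, overlap, frobSq]
  push_cast
  exact Finset.sum_congr rfl fun x _ => Finset.sum_congr rfl fun y _ => Complex.conj_mul' _

theorem HasSchmidt.sum_eq {W : Matrix X Y ℂ} {w : ι → ℝ} (h : HasSchmidt W w) :
    ∑ i, w i = frobSq W := by
  obtain ⟨E, G, hE, hG, rfl⟩ := h
  apply Complex.ofReal_injective
  rw [← trace_conjTranspose_mul_self_eq_frobSq, conjTranspose_mul, Matrix.mul_assoc,
    ← Matrix.mul_assoc Eᴴ, hE, Matrix.one_mul, trace_mul_comm, hG, trace_diagonal]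
  push_cast
  rfl

theorem HasSchmidt.kronecker {W : Matrix X Y ℂ} {w : ι → ℝ} {W' : Matrix K L ℂ} {w' : κ → ℝ}
    (h : HasSchmidt W w) (h' : HasSchmidt W' w') :
    HasSchmidt (W ⊗ₖ W') (fun i : ι × κ => w i.1 * w' i.2) := by
  obtain ⟨E, G, hE, hG, rfl⟩ := h
  obtain ⟨E', G', hE', hG', rfl⟩ := h'
  refine ⟨E ⊗ₖ E', G ⊗ₖ G', ?_, ?_, ?_⟩
  · rw [conjTranspose_kronecker, ← mul_kronecker_mul, hE, hE', one_kronecker_one]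
  · rw [conjTranspose_kronecker, ← mul_kronecker_mul, hG, hG', diagonal_kronecker_diagonal]
    simp
  · rw [mul_kronecker_mul]

theorem HasSchmidt.pow {W : Matrix X Y ℂ} {w : ι → ℝ} (h : HasSchmidt W w) (n : ℕ) :
    HasSchmidt (Matrix.of fun (x : Fin n → X) (y : Fin n → Y) => ∏ k, W (x k) (y k))
      (fun I : Fin n → ι => ∏ k, w (I k)) := by
  obtain ⟨E, G, hE, hG, rfl⟩ := h
  refine ⟨Matrix.of fun x I => ∏ k, E (x k) (I k), Matrix.of fun I y => ∏ k, G (I k) (y k),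
    ?_, ?_, ?_⟩
  · ext I J
    simp only [Matrix.mul_apply, conjTranspose_apply, of_apply, star_prod, ← Finset.prod_mul_distrib]
    rw [← Fintype.prod_sum (fun k x => star (E x (I k)) * E x (J k))]
    have : ∀ i j, ∑ x, star (E x i) * E x j = if i = j then 1 else 0 := by
      intro i j
      simpa [Matrix.mul_apply, Matrix.one_apply] using congrFun (congrFun hE i) j
    simp only [this, Matrix.one_apply, funext_iff, Finset.prod_ite_zero]
    simp
  · ext I J
    simp only [Matrix.mul_apply, conjTranspose_apply, of_apply, star_prod, ← Finset.prod_mul_distrib]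
    rw [← Fintype.prod_sum (fun k y => G (I k) y * star (G (J k) y))]
    have : ∀ i j, ∑ y, G i y * star (G j y) = if i = j then (w i : ℂ) else 0 := by
      intro i j
      simpa [Matrix.mul_apply, diagonal_apply] using congrFun (congrFun hG i) j
    simp only [this, diagonal_apply, funext_iff, Finset.prod_ite_zero]
    simp
  · ext x y
    simp only [Matrix.mul_apply, of_apply, ← Finset.prod_mul_distrib]
    rw [← Fintype.prod_sum (fun k i => E (x k) i * G i (y k))]

/-- The Kraus operators `A k`, stacked to a single matrix. -/
def stack {d : ℕ} (A : K → Matrix X (Fin d) ℂ) : Matrix (X × K) (Fin d) ℂ :=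
  Matrix.of fun x i => A x.2 x.1 i

theorem stack_conjTranspose_mul_self {d : ℕ} (A : K → Matrix X (Fin d) ℂ) :
    (stack A)ᴴ * stack A = ∑ k, (A k)ᴴ * A k := by
  ext i j
  simp only [stack, Matrix.mul_apply, Matrix.sum_apply, conjTranspose_apply, of_apply,
    Fintype.sum_prod_type_right]

theorem branch_stack_apply {d : ℕ} (A : K → Matrix X (Fin d) ℂ) (B : L → Matrix Y (Fin d) ℂ)
    (x : X × K) (y : Y × L) :
    branch (stack A) (stack B) x y = branch (A x.2) (B y.2) x.1 y.1 := by
  simp [branch, stack, Matrix.mul_apply]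

theorem frobSq_branch_stack {d : ℕ} (A : K → Matrix X (Fin d) ℂ) (B : L → Matrix Y (Fin d) ℂ) :
    frobSq (branch (stack A) (stack B)) = ∑ k, ∑ l, frobSq (branch (A k) (B l)) := by
  simp only [frobSq, branch_stack_apply, Fintype.sum_prod_type_right]
  refine Finset.sum_congr rfl fun k _ => ?_
  rw [Finset.sum_comm]

/-- The private indices become systems of the two parties, and `χ` is a state on them; a good `χ`
combines all overlaps of one transcript into a single overlap. -/
theorem overlap_branch_stack {d : ℕ} (A : K → Matrix X (Fin d) ℂ) (B : L → Matrix Y (Fin d) ℂ)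
    (W : Matrix X Y ℂ) (χ : Matrix K L ℂ) :
    overlap (W ⊗ₖ χ) (branch (stack A) (stack B)) =
      ∑ k, ∑ l, star (χ k l) * overlap W (branch (A k) (B l)) := by
  simp only [overlap, branch_stack_apply, Fintype.sum_prod_type_right, kronecker_apply]
  refine Finset.sum_congr rfl fun k _ => ?_
  rw [Finset.sum_comm]
  refine Finset.sum_congr rfl fun l _ => ?_
  simp only [Finset.mul_sum]
  refine Finset.sum_congr rfl fun x _ => Finset.sum_congr rfl fun y _ => ?_
  rw [star_mul']
  ring

/-- Tensoring with any other weights does not make the weights `w` more concentrated. -/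
theorem sum_window_prod_le {w : ι → ℝ} {v : κ → ℝ} (hv : ∀ j, 0 ≤ v j) (hv1 : ∑ j, v j = 1)
    {l h R m : ℝ} (hl : 0 < l) (hlh : h < l * R)
    (hw : ∀ l h : ℝ, 0 < l → h < l * R → ∑ i with l ≤ w i ∧ w i ≤ h, w i ≤ m) :
    ∑ i : ι × κ with l ≤ w i.1 * v i.2 ∧ w i.1 * v i.2 ≤ h, w i.1 * v i.2 ≤ m := by
  rw [Finset.sum_filter, Fintype.sum_prod_type_right]
  calc _ ≤ ∑ j, m * v j := by
        refine Finset.sum_le_sum fun j _ => ?_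
        rcases (hv j).eq_or_lt with hj | hj
        · simp [← hj]
        -- For fixed `j` the condition on `w` is the window divided by `v j`, which has the same
        -- ratio.
        · refine le_trans (le_of_eq ?_) (mul_le_mul_of_nonneg_right
            (hw (l / v j) (h / v j) (by positivity) ?_) hj.le)
          · rw [Finset.sum_mul, Finset.sum_filter]
            simp only [div_le_iff₀ hj, le_div_iff₀ hj]
          · rw [div_mul_eq_mul_div]
            gcongr
    _ = m := by rw [← Finset.mul_sum, hv1, mul_one]

/-- Local operations without communication turn `|Φ_d⟩` into a vector whose Schmidt coefficients
are spread out only with small amplitude. -/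
theorem sqrt_sum_norm_overlap_sq_le {d : ℕ} (hd : 0 < d) {W : Matrix X Y ℂ} {w : ι → ℝ}
    (hW : HasSchmidt W w) (hw1 : ∑ i, w i = 1)
    {A : K → Matrix X (Fin d) ℂ} {B : L → Matrix Y (Fin d) ℂ}
    (hA : ∑ k, (A k)ᴴ * A k ≤ 1) (hB : ∑ l, (B l)ᴴ * B l ≤ 1)
    {l h R m : ℝ} (hl : 0 < l) (hlh' : l ≤ h) (hlh : h < l * R)
    (hw : ∀ l h : ℝ, 0 < l → h < l * R → ∑ i with l ≤ w i ∧ w i ≤ h, w i ≤ m) :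
    √(∑ k, ∑ l, ‖overlap W (branch (A k) (B l))‖ ^ 2) ≤
      1 / √(d * h) + √(d * l) + √m * √(∑ k, ∑ l, frobSq (branch (A k) (B l))) := by
  -- The matrix of overlaps itself, normalized, is the optimal ancilla state: it attains equality in
  -- Cauchy–Schwarz, giving overlap `√(frobSq χ)`.
  set χ : Matrix K L ℂ := Matrix.of fun k l => overlap W (branch (A k) (B l)) with hχ
  have hF : ∑ k, ∑ l, ‖overlap W (branch (A k) (B l))‖ ^ 2 = frobSq χ := rfl
  rw [hF]
  rcases (frobSq_nonneg χ).eq_or_lt with h0 | h0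
  · rw [← h0, Real.sqrt_zero]; positivity
  set r : ℝ := (√(frobSq χ))⁻¹ with hr
  have hrpos : 0 < √(frobSq χ) := Real.sqrt_pos.2 h0
  have hfr : frobSq ((r : ℂ) • χ) = 1 := by
    have : frobSq ((r : ℂ) • χ) = r ^ 2 * frobSq χ := by
      simp [frobSq, mul_pow, Finset.mul_sum]
    rw [this, hr, inv_pow, Real.sq_sqrt h0.le, inv_mul_cancel₀ h0.ne']
  have hS := hasSchmidt_eigenvalues _ (isHermitian_mul_conjTranspose_self ((r : ℂ) • χ))
  generalize (isHermitian_mul_conjTranspose_self ((r : ℂ) • χ)).eigenvalues = v at hS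
  have hv1 : ∑ j, v j = 1 := hS.sum_eq.trans hfr
  have hU := hW.kronecker hS
  have hU1 : ∑ i : ι × K, w i.1 * v i.2 ≤ 1 := by
    rw [Fintype.sum_prod_type, ← Fintype.sum_mul_sum, hw1, hv1, mul_one]
  have key := norm_overlap_le_of_contractions hd hU hU1
    (norm_le_one_of_conjTranspose_mul_self_le_one ((stack_conjTranspose_mul_self A).trans_le hA))
    (norm_transpose_le_one_of_conjTranspose_mul_self_le_one
      ((stack_conjTranspose_mul_self B).trans_le hB)) (hl.trans_le hlh') hlh'
  change ‖overlap _ (branch (stack A) (stack B))‖ ≤ _ + _ * √(frobSq (branch (stack A) (stack B)))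
    at key
  rw [frobSq_branch_stack, overlap_branch_stack] at key
  have e : ∑ k, ∑ l, star (((r : ℂ) • χ) k l) * overlap W (branch (A k) (B l)) =
      ((√(frobSq χ) : ℝ) : ℂ) := by
    have : ∑ k, ∑ l, star (((r : ℂ) • χ) k l) * overlap W (branch (A k) (B l)) =
        ((r * frobSq χ : ℝ) : ℂ) := by
      simp only [frobSq, Finset.mul_sum]
      push_cast
      refine Finset.sum_congr rfl fun k _ => Finset.sum_congr rfl fun l _ => ?_
      rw [← Complex.conj_mul']
      simp [hχ, mul_assoc]
    rw [this, hr, inv_mul_eq_div, Real.div_sqrt]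
  rw [e, Complex.norm_real, Real.norm_of_nonneg hrpos.le] at key
  refine key.trans ?_
  gcongr
  exact sum_window_prod_le hS.nonneg hv1 hl hlh hw

/-- A branch factors through `ℂ^d`, so its Schmidt rank is at most `d`. -/
theorem norm_overlap_branch_le {d : ℕ} {W : Matrix X Y ℂ} {w : ι → ℝ} (hW : HasSchmidt W w)
    (A : Matrix X (Fin d) ℂ) (B : Matrix Y (Fin d) ℂ) {l : ℝ} (hl : 0 ≤ l) :
    ‖overlap W (branch A B)‖ ≤
      (√(∑ i with l < w i, w i) + √(d * l)) * √(frobSq (branch A B)) := by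
  refine norm_overlap_le_of_rank hW ?_ hl
  rw [branch, ← Matrix.smul_mul]
  refine (rank_mul_le_left _ _).trans ((rank_le_card_width _).trans_eq ?_)
  simp

/-- If all non-zero squared Schmidt coefficients agree, the state is maximally entangled. -/
theorem isMaximallyEntangled_of_hasSchmidt {p q : ℕ} {ψ : EuclideanSpace ℂ (Fin p × Fin q)}
    {w : ι → ℝ} (h : HasSchmidt (Matrix.of fun i j => ψ (i, j)) w) (h1 : ∑ i, w i = 1) {m : ℝ}
    (hm : ∀ i, 0 < w i → w i = m) : IsMaximallyEntangled ψ := by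
  have h0 := h.nonneg
  obtain ⟨E, G, hE, hG, hW⟩ := h
  set r := Fintype.card {i // 0 < w i} with hr
  have hrm : (r : ℝ) * m = 1 := by
    rw [← h1, ← Finset.sum_filter_of_ne (p := fun i => 0 < w i)
      (fun i _ hi => lt_of_le_of_ne (h0 i) hi.symm),
      Finset.sum_congr rfl fun i hi => hm i (Finset.mem_filter.1 hi).2, Finset.sum_const,
      nsmul_eq_mul, hr, Fintype.card_subtype]
  have hr0 : (0 : ℝ) < r := by
    refine lt_of_le_of_ne (by positivity) fun h => ?_
    rw [← h] at hrm; simp at hrm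
  have hsr : √(r : ℝ) ≠ 0 := (Real.sqrt_pos.2 hr0).ne'
  let e : Fin r ≃ {i // 0 < w i} := (Fintype.equivFin _).symm
  have hEE : ∀ i j, ∑ x, star (E x i) * E x j = if i = j then 1 else 0 := by
    intro i j
    simpa [Matrix.mul_apply, Matrix.one_apply] using congrFun (congrFun hE i) j
  have hGG : ∀ i j, ∑ y, G i y * star (G j y) = if i = j then (w i : ℂ) else 0 := by
    intro i j
    simpa [Matrix.mul_apply, diagonal_apply] using congrFun (congrFun hG i) j
  -- The surviving rows of `G` have squared norm `m = 1 / r`, so multiplying by `√r` makes them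
  -- orthonormal.
  refine ⟨r, fun k => WithLp.toLp 2 fun x => E x (e k),
    fun k => WithLp.toLp 2 fun y => ((√(r : ℝ) : ℝ) : ℂ) * G (e k) y, ?_, ?_, ?_⟩
  · rw [orthonormal_iff_ite]
    intro k l
    have := hEE (e k) (e l)
    simp only [PiLp.inner_apply, RCLike.inner_apply']
    refine this.trans ?_
    simp [Subtype.ext_iff.symm]
  · rw [orthonormal_iff_ite]
    intro k l
    simp only [PiLp.inner_apply, RCLike.inner_apply']
    have : ∑ y, (starRingEnd ℂ) (((√(r : ℝ) : ℝ) : ℂ) * G (e k) y) *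
        (((√(r : ℝ) : ℝ) : ℂ) * G (e l) y) = (r : ℂ) * ∑ y, G (e l) y * star (G (e k) y) := by
      rw [Finset.mul_sum]
      refine Finset.sum_congr rfl fun y _ => ?_
      have h2 : ((√(r : ℝ) : ℝ) : ℂ) * ((√(r : ℝ) : ℝ) : ℂ) = (r : ℂ) := by
        rw [← Complex.ofReal_mul, Real.mul_self_sqrt hr0.le]; simp
      rw [← h2, map_mul, Complex.conj_ofReal, starRingEnd_apply]
      ring
    rw [this, hGG]
    by_cases hkl : k = l
    · subst hkl
      simp only [if_true, hm _ (e k).2]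
      exact_mod_cast hrm
    · have : ¬ ((e l : ι) = (e k : ι)) := fun h => hkl (e.injective (Subtype.ext h)).symm
      simp [hkl, this]
  · intro i j
    have h2 := congrFun (congrFun hW i) j
    simp only [of_apply, Matrix.mul_apply] at h2
    rw [h2, Finset.mul_sum]
    have h3 : ∑ t, E i t * G t j = ∑ t : {i // 0 < w i}, E i t * G t j := by
      rw [← Finset.sum_subtype (Finset.univ.filter fun t => 0 < w t) (by simp)
        (fun t => E i t * G t j)]
      refine (Finset.sum_filter_of_ne fun t _ ht => ?_).symm
      refine lt_of_le_of_ne (h0 t) fun h => ht ?_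
      rw [row_eq_zero hG h.symm, mul_zero]
    rw [h3, ← e.sum_comp]
    refine Finset.sum_congr rfl fun k _ => ?_
    have h4 : (((√(r : ℝ))⁻¹ : ℝ) : ℂ) * ((√(r : ℝ) : ℝ) : ℂ) = 1 := by
      rw [← Complex.ofReal_mul, inv_mul_cancel₀ hsr, Complex.ofReal_one]
    linear_combination -(E i (e k) * G (e k) j) * h4

end

/-! ### From fidelity to bounds on dimension and communication -/

section
open Matrix
open scoped ComplexOrder

/-- Minkowski's inequality for a bound `√F ≤ x + √(m p)` that holds on each of finitely many
transcripts. -/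
theorem sum_le_of_sqrt_le {T : Type} [Fintype T] {F p : T → ℝ} (hF : ∀ t, 0 ≤ F t)
    (hp : ∀ t, 0 ≤ p t) {x m y : ℝ}
    (h : ∀ t, √(F t) ≤ x + √m * √(p t)) (hy : 0 ≤ y)
    (hxy : Fintype.card T * x ^ 2 ≤ y ^ 2 * ∑ t, p t) :
    ∑ t, F t ≤ (y + √m) ^ 2 * ∑ t, p t := by
  have hP : 0 ≤ ∑ t, p t := Finset.sum_nonneg fun t _ => hp t
  have h1 : ∑ t, F t ≤ ∑ t, (x + √m * √(p t)) ^ 2 := by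
    refine Finset.sum_le_sum fun t _ => ?_
    rw [← Real.sq_sqrt (hF t)]
    exact pow_le_pow_left₀ (Real.sqrt_nonneg _) (h t) 2
  have h2 : ∑ t, (x + √m * √(p t)) ^ 2 =
      Fintype.card T * x ^ 2 + 2 * √m * ∑ t, x * √(p t) + √m ^ 2 * ∑ t, p t := by
    have : ∀ t, (x + √m * √(p t)) ^ 2 = x ^ 2 + 2 * √m * (x * √(p t)) + √m ^ 2 * p t := by
      intro t
      have := Real.sq_sqrt (hp t)
      linear_combination √m ^ 2 * this
    simp only [this, Finset.sum_add_distrib, Finset.mul_sum, Finset.sum_const, nsmul_eq_mul,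
      Finset.card_univ]
  have h3 : ∑ t, x * √(p t) ≤ y * ∑ t, p t := by
    calc ∑ t, x * √(p t) ≤ √(∑ _t : T, x ^ 2) * √(∑ t, √(p t) ^ 2) :=
          Real.sum_mul_le_sqrt_mul_sqrt _ _ _
      _ ≤ √(y ^ 2 * ∑ t, p t) * √(∑ t, p t) := by
          gcongr
          · simpa using hxy
          · simp only [Real.sq_sqrt (hp _)]; exact le_rfl
      _ = y * ∑ t, p t := by
          rw [Real.sqrt_mul (sq_nonneg y), Real.sqrt_sq hy, mul_assoc, Real.mul_self_sqrt hP]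
  calc _ ≤ _ := h1
    _ = _ := h2
    _ ≤ y ^ 2 * ∑ t, p t + 2 * √m * (y * ∑ t, p t) + √m ^ 2 * ∑ t, p t := by gcongr
    _ = _ := by ring

theorem sqrt_twelve_thirteenths_le : √(12 / 13 : ℝ) ≤ 97 / 100 :=
  Real.sqrt_le_iff.2 ⟨by norm_num, by norm_num⟩

theorem traceB_pureState_eq {X Y : Type} [Fintype X] [Fintype Y] (v : X × Y → ℂ) :
    traceB (pureState v) =
      (Matrix.of fun x y => v (x, y)) * (Matrix.of fun x y => v (x, y))ᴴ := by
  ext i j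
  simp [traceB, pureState, Matrix.mul_apply, vecMulVec_apply]

theorem hasSchmidt_eigenvalues_of_eq {X Y : Type} [Fintype X] [DecidableEq X] [Fintype Y]
    [DecidableEq Y] {W : Matrix X Y ℂ} {M : Matrix X X ℂ} (hM : M = W * Wᴴ) (h : M.IsHermitian) :
    HasSchmidt W h.eigenvalues := by
  subst hM
  exact hasSchmidt_eigenvalues W h

section
variable {X Y ι T : Type} [Fintype X] [DecidableEq X] [Fintype Y] [DecidableEq Y] [Fintype ι]
  [DecidableEq ι] [Fintype T] {K L : T → Type} [∀ t, Fintype (K t)] [∀ t, Fintype (L t)]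
  {d : ℕ} {A : (t : T) → K t → Matrix X (Fin d) ℂ} {B : (t : T) → L t → Matrix Y (Fin d) ℂ}
  {W : Matrix X Y ℂ} {w : ι → ℝ}

/-- A fidelity above `99 / 100` with a state that has weight at most `12 / 13` on its Schmidt
coefficients above `l` requires `d` to be of the order of `l⁻¹`. -/
theorem one_div_lt_mul_of_fidelity (hW : HasSchmidt W w) {l : ℝ} (hl : 0 ≤ l)
    (hw : ∑ i with l < w i, w i ≤ 12 / 13)
    (hpos : 0 < ∑ t, ∑ k, ∑ l, frobSq (branch (A t k) (B t l)))
    (hfid : 99 / 100 * ∑ t, ∑ k, ∑ l, frobSq (branch (A t k) (B t l)) ≤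
      ∑ t, ∑ k, ∑ l, ‖overlap W (branch (A t k) (B t l))‖ ^ 2) :
    1 / 2 ^ 12 < d * l := by
  by_contra! hcon
  -- The constant `2 ^ 12 = 64 ^ 2` makes `(97 / 100 + 1 / 64)² < 98 / 100`, below the fidelity `99
  -- / 100`.
  have hs : √(d * l) ≤ 1 / 64 := Real.sqrt_le_iff.2 ⟨by norm_num, hcon.trans (by norm_num)⟩
  have hs' : √(∑ i with l < w i, w i) ≤ 97 / 100 :=
    (Real.sqrt_le_sqrt hw).trans sqrt_twelve_thirteenths_le
  have hb : ∑ t, ∑ k, ∑ l, ‖overlap W (branch (A t k) (B t l))‖ ^ 2 ≤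
      ∑ t, ∑ k, ∑ l, 98 / 100 * frobSq (branch (A t k) (B t l)) := by
    refine Finset.sum_le_sum fun t _ => Finset.sum_le_sum fun k _ =>
      Finset.sum_le_sum fun j _ => ?_
    have h0 := frobSq_nonneg (branch (A t k) (B t j))
    calc _ ≤ ((√(∑ i with l < w i, w i) + √(d * l)) *
            √(frobSq (branch (A t k) (B t j)))) ^ 2 :=
          pow_le_pow_left₀ (norm_nonneg _) (norm_overlap_branch_le hW _ _ hl) 2
      _ ≤ ((97 / 100 + 1 / 64) * √(frobSq (branch (A t k) (B t j)))) ^ 2 := by gcongr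
      _ ≤ _ := by
          rw [mul_pow, Real.sq_sqrt h0]
          gcongr
          norm_num
  simp only [← Finset.mul_sum] at hb
  linarith

/-- A fidelity above `99 / 100` with a state whose Schmidt coefficients are not concentrated in a
window of width `R` requires `R` to be at most of the order of the square of the number of
transcripts over the success probability. -/
theorem window_le_of_fidelity (hd : 0 < d) (hW : HasSchmidt W w) (hw1 : ∑ i, w i = 1)
    (hA : ∀ t, ∑ k, (A t k)ᴴ * A t k ≤ 1) (hB : ∀ t, ∑ k, (B t k)ᴴ * B t k ≤ 1)
    {R τ : ℝ} (hτ : 0 < τ) (hτ1 : τ ≤ 1)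
    (hw : ∀ l h : ℝ, 0 < l → h < l * R → ∑ i with l ≤ w i ∧ w i ≤ h, w i ≤ 12 / 13)
    (hpos : 0 < ∑ t, ∑ k, ∑ l, frobSq (branch (A t k) (B t l)))
    (hcard : Fintype.card T * τ ≤ ∑ t, ∑ k, ∑ l, frobSq (branch (A t k) (B t l)))
    (hfid : 99 / 100 * ∑ t, ∑ k, ∑ l, frobSq (branch (A t k) (B t l)) ≤
      ∑ t, ∑ k, ∑ l, ‖overlap W (branch (A t k) (B t l))‖ ^ 2) :
    R ≤ (2 ^ 20 / τ) ^ 2 := by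
  classical
  by_contra! hcon
  have hd' : (0 : ℝ) < d := by exact_mod_cast hd
  have key : ∀ t, √(∑ k, ∑ l, ‖overlap W (branch (A t k) (B t l))‖ ^ 2) ≤
      √τ / 512 + √(12 / 13) * √(∑ k, ∑ l, frobSq (branch (A t k) (B t l))) := by
    intro t
    have hsC : √(τ / 2 ^ 20) = √τ / 1024 := by
      rw [Real.sqrt_div' _ (by positivity)]
      congr 1
      rw [show (2 : ℝ) ^ 20 = 1024 ^ 2 by norm_num, Real.sqrt_sq (by norm_num)]
    have h1 := sqrt_sum_norm_overlap_sq_le hd hW hw1 (hA t) (hB t)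
      -- A window symmetric about `1 / d` on the logarithmic scale, of ratio `(2 ^ 20 / τ) ^ 2`;
      -- each of its two error terms equals `√τ / 1024`.
      (l := τ / (d * 2 ^ 20)) (h := 2 ^ 20 / (d * τ)) (R := R) (by positivity) ?_ ?_ hw
    · refine h1.trans_eq ?_
      congr 1
      have e1 : (d : ℝ) * (2 ^ 20 / (d * τ)) = (τ / 2 ^ 20)⁻¹ := by field_simp
      have e2 : (d : ℝ) * (τ / (d * 2 ^ 20)) = τ / 2 ^ 20 := by field_simp
      rw [e1, e2, Real.sqrt_inv, one_div, inv_inv, hsC]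
      ring
    · rw [div_le_div_iff₀ (by positivity) (by positivity)]
      calc τ * (d * τ) ≤ 1 * (d * 1) := by gcongr
        _ ≤ _ := by linarith
    · have e : 2 ^ 20 / (d * τ) = τ / (d * 2 ^ 20) * (2 ^ 20 / τ) ^ 2 := by field_simp
      rw [e]
      gcongr
  have hfin := sum_le_of_sqrt_le (y := 1 / 512) (fun t => by positivity)
    (fun t => Finset.sum_nonneg fun k _ => Finset.sum_nonneg fun l _ => frobSq_nonneg _)
    key (by norm_num) (by
      rw [div_pow, Real.sq_sqrt hτ.le]
      linarith)
  have hc : (1 / 512 + √(12 / 13 : ℝ)) ^ 2 ≤ 98 / 100 := by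
    have := sqrt_twelve_thirteenths_le
    calc _ ≤ (1 / 512 + 97 / 100 : ℝ) ^ 2 := by gcongr
      _ ≤ _ := by norm_num
  nlinarith

end

/-- A trace distance of at most `1 / 100` bounds the fidelity of the unnormalized output. -/
theorem fidelity_of_traceDist_le {X Y : Type} [Fintype X] [Fintype Y] [DecidableEq X]
    [DecidableEq Y] {d c : ℕ} {P : Protocol X Y d d c} {u : X × Y → ℂ}
    (hu : ∑ x, ‖u x‖ ^ 2 = 1) (hpos : 0 < P.successProb (pureState (maxEntangled d)))
    (hD : traceDist (P.output (pureState (maxEntangled d))) (pureState u) ≤ 1 / 100) :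
    99 / 100 * P.successProb (pureState (maxEntangled d)) ≤
      (star u ⬝ᵥ (P.run (pureState (maxEntangled d)) *ᵥ u)).re := by
  have hrun := (P.posSemidef_run (posSemidef_pureState (maxEntangled d))).isHermitian
  have hout : (P.output (pureState (maxEntangled d))).IsHermitian := by
    unfold Protocol.output
    rw [IsHermitian, conjTranspose_smul, hrun]
    simp
  have h := one_sub_traceDist_le hout hu
  have e : (star u ⬝ᵥ (P.output (pureState (maxEntangled d)) *ᵥ u)).re =
      (P.successProb (pureState (maxEntangled d)))⁻¹ *
        (star u ⬝ᵥ (P.run (pureState (maxEntangled d)) *ᵥ u)).re := by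
    rw [Protocol.output, smul_mulVec, dotProduct_smul, smul_eq_mul, ← Complex.ofReal_inv,
      Complex.re_ofReal_mul]
  rw [e] at h
  have h2 : 99 / 100 ≤ (P.successProb (pureState (maxEntangled d)))⁻¹ *
      (star u ⬝ᵥ (P.run (pureState (maxEntangled d)) *ᵥ u)).re := by linarith
  rwa [inv_mul_eq_div, le_div_iff₀ hpos] at h2

end

end EntanglementDilution

end

/-! ### The theorem: choice of constants -/

theorem theorem1 :
    ∃ ε₀ : ℝ, 1 / 100 ≤ ε₀ ∧
      ∀ (p q : ℕ) (ψ : EuclideanSpace ℂ (Fin p × Fin q)), ‖ψ‖ = 1 →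
        ¬ EntanglementDilution.IsSeparable ψ →
        ¬ EntanglementDilution.IsMaximallyEntangled ψ →
        ∃ (α : ℝ) (n₀ : ℕ), 0 < α ∧
          ∀ ε : ℝ, ε ≤ ε₀ → ∀ n : ℕ, n₀ ≤ n →
            ∀ (d c : ℕ) (s : ℝ)
              (P : EntanglementDilution.Protocol (Fin n → Fin p) (Fin n → Fin q) d d c),
              (2 : ℝ) ^ (-s) ≤
                P.successProb
                  (EntanglementDilution.pureState (EntanglementDilution.maxEntangled d)) →
              EntanglementDilution.traceDist
                (P.output
                  (EntanglementDilution.pureState (EntanglementDilution.maxEntangled d)))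
                (EntanglementDilution.pureState (EntanglementDilution.tensorPow ψ n)) ≤ ε →
              n * EntanglementDilution.entanglementEntropy ψ + α * √(n : ℝ) ≤ Real.logb 2 d ∧
                α * √(n : ℝ) ≤ c + s := by
  refine ⟨1 / 100, le_rfl, fun p q ψ hψ _ hmax => ?_⟩
  let W : Matrix (Fin p) (Fin q) ℂ := Matrix.of fun i j => ψ (i, j)
  obtain ⟨μ, hS, hH⟩ : ∃ μ : Fin p → ℝ, EntanglementDilution.HasSchmidt W μ ∧
      EntanglementDilution.entanglementEntropy ψ = -∑ i, μ i * Real.logb 2 (μ i) :=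
    ⟨_, EntanglementDilution.hasSchmidt_eigenvalues_of_eq
      (EntanglementDilution.traceB_pureState_eq ψ.ofLp) _, rfl⟩
  have hμ1 : ∑ i, μ i = 1 := by
    rw [hS.sum_eq]
    have h := EuclideanSpace.norm_sq_eq ψ
    rw [hψ, one_pow, Fintype.sum_prod_type] at h
    exact h.symm
  -- Otherwise all non-zero weights equal `2 ^ (-E)` and the state is maximally entangled.
  have hne : ∃ i, 0 < μ i ∧
      Real.logb 2 (μ i) ≠ -EntanglementDilution.entanglementEntropy ψ := by
    by_contra! hcon
    refine hmax (EntanglementDilution.isMaximallyEntangled_of_hasSchmidt hS hμ1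
      (m := (2 : ℝ) ^ (-EntanglementDilution.entanglementEntropy ψ)) fun i hi => ?_)
    rw [← hcon i hi, Real.rpow_logb (by norm_num) (by norm_num) hi]
  obtain ⟨β, hβ, n₁, hn₁⟩ :=
    EntanglementDilution.exists_anticoncentration hS.nonneg hμ1 hH hne
  -- Half of `β √n` is kept for the result; the other half exceeds `20` and absorbs the constants
  -- `12` in (a) and `20` in (b).
  obtain ⟨n₂, hn₂⟩ := exists_nat_gt ((20 / (β / 2)) ^ 2)
  refine ⟨β / 2, max n₁ n₂, by positivity, fun ε hε n hn d c s P hP hD => ?_⟩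
  obtain ⟨hheavy, hwindow⟩ := hn₁ n (le_of_max_le_left hn)
  have hαn : 20 < β / 2 * √(n : ℝ) := by
    rw [← div_lt_iff₀' (by positivity)]
    refine Real.lt_sqrt_of_sq_lt (hn₂.trans_le ?_)
    exact_mod_cast le_of_max_le_right hn
  have hpos := (Real.rpow_pos_of_pos (by norm_num : (0 : ℝ) < 2) (-s)).trans_le hP
  have hSn := hS.pow n
  have hw1 : ∑ I : Fin n → Fin p, ∏ k, μ (I k) = 1 := by
    rw [← Fintype.sum_pow, hμ1, one_pow]
  have hu1 : ∑ x, ‖EntanglementDilution.tensorPow ψ n x‖ ^ 2 = 1 := by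
    rw [Fintype.sum_prod_type, ← hw1, hSn.sum_eq]
    rfl
  have hfid := EntanglementDilution.fidelity_of_traceDist_le hu1 hpos (hD.trans hε)
  obtain ⟨T, _, K, L, _, _, A, B, hT, hA, hB, hrun⟩ := P.exists_kraus
  obtain ⟨hprob, hover⟩ := EntanglementDilution.run_maxEntangled hrun
  rw [hover _ _ fun x y => rfl, Complex.ofReal_re, hprob] at hfid
  rw [hprob] at hP hpos
  have hd : 0 < d := by
    rcases Nat.eq_zero_or_pos d with rfl | hd
    · simp [EntanglementDilution.branch, EntanglementDilution.frobSq] at hpos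
    · exact hd
  have hd' : (0 : ℝ) < d := by exact_mod_cast hd
  constructor
  · have h1 := EntanglementDilution.one_div_lt_mul_of_fidelity hSn (by positivity) hheavy hpos hfid
    have h2 : Real.logb 2 (1 / 2 ^ 12) < _ :=
      Real.logb_lt_logb (b := 2) (by norm_num) (by norm_num) h1
    rw [Real.logb_mul hd'.ne' (by positivity), Real.logb_rpow (by norm_num) (by norm_num),
      one_div, Real.logb_inv, Real.logb_pow, Real.logb_self_eq_one (by norm_num)] at h2
    push_cast at h2
    linarith
  · by_contra! hcon
    -- The maximum ensures `2 ^ (-m) ≤ 1` even if `c + s` is negative, as `s` is an arbitrary real.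
    set m := max ((c : ℝ) + s) 0 with hm
    have hmlt : m < β / 2 * √(n : ℝ) := max_lt hcon (by linarith)
    have h1 := EntanglementDilution.window_le_of_fidelity (τ := (2 : ℝ) ^ (-m)) hd hSn hw1 hA hB
      (by positivity) (Real.rpow_le_one_of_one_le_of_nonpos (by norm_num)
        (neg_nonpos.2 (le_max_right _ _))) hwindow hpos ?_ hfid
    · have e : ((2 : ℝ) ^ 20 / 2 ^ (-m)) ^ 2 = 2 ^ (2 * (20 + m)) := by
        rw [Real.rpow_neg (by norm_num), div_inv_eq_mul, mul_comm 2, Real.rpow_mul (by norm_num),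
          Real.rpow_add (by norm_num)]
        norm_num
      rw [e, Real.rpow_le_rpow_left_iff (by norm_num)] at h1
      linarith
    · refine le_trans ?_ hP
      calc (Fintype.card T : ℝ) * 2 ^ (-m) ≤ 2 ^ (c : ℝ) * 2 ^ (-m) := by
            gcongr
            rw [Real.rpow_natCast]
            exact_mod_cast hT
        _ = 2 ^ ((c : ℝ) - m) := by
            rw [← Real.rpow_add (by norm_num), sub_eq_add_neg]
        _ ≤ 2 ^ (-s) := by
            refine Real.rpow_le_rpow_of_exponent_le (by norm_num) ?_
            linarith [le_max_left ((c : ℝ) + s) 0]
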